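/- Let $d\in\mathbb N$. Let $\dot W^1_1(\mathbb R^d)$ be the space of complex-valued distributions $f\in\mathscr D'(\mathbb R^d)$ with $\partial_j f\in L^1(\mathbb R^d)$ for $j=1,\dots,d$, modulo constants, with norm $\sum_{j=1}^d\|\partial_j f\|_{L^1(\mathbb R^d)}$. A function $m\in L^\infty(\mathbb R^d)$ (complex-valued) is called a Fourier multiplier on $\dot W^1_1(\mathbb R^d)$ with corresponding operator $T$ if $T:\dot W^1_1(\mathbb R^d)\to\dot W^1_1(\mathbb R^d)$ is a bounded linear operator such that $\widehat{Tf}=m\hat f$ for every Schwartz function $f\in\mathscr S(\mathbb R^d)$, i.e. the class $Tf$ has a tempered representative whose Fourier transform is $m\hat f$; it is called a Fourier multiplier on $\dot W^1_1(\mathbb R^d)$ if such a $T$ exists. Let $(m_k)_{k\in\mathbb N}$ be a sequence of Fourier multipliers on $\dot W^1_1(\mathbb R^d)$ with corresponding operators $T_k$, and suppose that $\sup_k\|T_k\|<\infty$. Let $m:\mathbb R^d\to\mathbb C$ be such that $m_k(\xi)\to m(\xi)$ for every $\xi\in\mathbb R^d$, and suppose that $\xi\mapsto m(\xi)\,\xi_j$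 is continuous on $\mathbb R^d$ for each $j\in\{1,\dots,d\}$. Then $m$ is a Fourier multiplier on $\dot W^1_1(\mathbb R^d)$ (in particular $m\in L^\infty(\mathbb R^d)$). -/

import Mathlib

noncomputable section

open MeasureTheory TopologicalSpace
open scoped Distributions SchwartzMap FourierTransform LineDeriv ENNReal ContDiff

namespace HomSobolev

/-- The Euclidean space `ℝ^d`. -/
abbrev Rd (d : ℕ) : Type := EuclideanSpace ℝ (Fin d)

/-- Complex-valued distributions on `ℝ^d`, i.e. the space `𝓓'(ℝ^d)`. -/
abbrev Distr (d : ℕ) : Type := 𝓓'((⊤ : Opens (Rd d)), ℂ)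

/-- The distribution `φ ↦ ∫ φ g` given by a locally integrable function `g`. -/
def ofFun {d : ℕ} (g : Rd d → ℂ) : Distr d :=
  TestFunction.integralAgainstBilinCLM (ContinuousLinearMap.lsmul ℝ ℝ) volume g

theorem ofFun_apply {d : ℕ} {g : Rd d → ℂ} (hg : LocallyIntegrable g)
    (φ : 𝓓((⊤ : Opens (Rd d)), ℝ)) : ofFun g φ = ∫ x, φ x • g x := by
  have h : LocallyIntegrableOn g ((⊤ : Opens (Rd d)) : Set (Rd d)) volume :=
    hg.locallyIntegrableOn _
  exact TestFunction.integralAgainstBilinCLM_eq_integral h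

theorem integrable_smul {d : ℕ} {g : Rd d → ℂ} (hg : LocallyIntegrable g)
    (φ : 𝓓((⊤ : Opens (Rd d)), ℝ)) : Integrable (fun x => φ x • g x) :=
  hg.integrable_smul_left_of_hasCompactSupport φ.continuous φ.hasCompactSupport

theorem L1_locallyIntegrable {d : ℕ} (g : Rd d →₁[volume] ℂ) : LocallyIntegrable g :=
  (L1.integrable_coeFn g).locallyIntegrable

/-- The inclusion of `L¹(ℝ^d)` into the distributions. -/
def ofL1 (d : ℕ) : (Rd d →₁[volume] ℂ) →ₗ[ℂ] Distr d where
  toFun g := ofFun g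
  map_add' f g := by
    ext φ
    change ofFun _ φ = ofFun _ φ + ofFun _ φ
    rw [ofFun_apply (L1_locallyIntegrable _), ofFun_apply (L1_locallyIntegrable _),
      ofFun_apply (L1_locallyIntegrable _), ← integral_add
        (integrable_smul (L1_locallyIntegrable f) φ) (integrable_smul (L1_locallyIntegrable g) φ)]
    refine integral_congr_ae ?_
    filter_upwards [Lp.coeFn_add f g] with x hx
    rw [hx, Pi.add_apply, smul_add]
  map_smul' c f := by
    ext φ
    change ofFun _ φ = c • ofFun _ φ
    rw [ofFun_apply (L1_locallyIntegrable _), ofFun_apply (L1_locallyIntegrable _),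
      ← integral_smul]
    refine integral_congr_ae ?_
    filter_upwards [Lp.coeFn_smul c f] with x hx
    simp [hx, mul_left_comm]

theorem ofL1_injective (d : ℕ) : Function.Injective (ofL1 d) := by
  intro f g hfg
  refine Lp.ext ?_
  refine ae_eq_of_integral_contDiff_smul_eq (L1_locallyIntegrable f) (L1_locallyIntegrable g) ?_
  intro φ hφ hc
  let ψ : 𝓓((⊤ : Opens (Rd d)), ℝ) := ⟨φ, hφ, hc, fun _ _ => trivial⟩
  have h : ofFun f ψ = ofFun g ψ := congrArg (fun u : Distr d => u ψ) hfg
  rw [ofFun_apply (L1_locallyIntegrable _), ofFun_apply (L1_locallyIntegrable _)] at h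
  exact h

/-- The distributional partial derivative `∂_j`, as a complex linear map on `𝓓'(ℝ^d)`. -/
def pderiv {d : ℕ} (j : Fin d) : Distr d →ₗ[ℂ] Distr d where
  toFun u := ∂_{EuclideanSpace.single j (1 : ℝ)} u
  map_add' u v := LineDeriv.lineDerivOp_add _ u v
  map_smul' c u := by
    ext φ
    change (∂_{EuclideanSpace.single j (1 : ℝ)} (c • u)) φ
      = c • (∂_{EuclideanSpace.single j (1 : ℝ)} u) φ
    rw [Distribution.lineDerivOp_apply_apply, Distribution.lineDerivOp_apply_apply]
    rfl

/-- The distributions on `ℝ^d` all of whose first order partial derivatives lie in `L¹(ℝ^d)`. -/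
def w11 (d : ℕ) : Submodule ℂ (Distr d) :=
  ⨅ j : Fin d, (LinearMap.range (ofL1 d)).comap (pderiv j)

/-- The homogeneous Sobolev space before passing to the quotient by the constants. It is a separate
type, so that it carries the topology of its seminorm and not the one of `𝓓'(ℝ^d)`. -/
def PreW11 (d : ℕ) : Type := w11 d

instance (d : ℕ) : AddCommGroup (PreW11 d) := inferInstanceAs (AddCommGroup (w11 d))

instance (d : ℕ) : Module ℂ (PreW11 d) := inferInstanceAs (Module ℂ (w11 d))

/-- The inclusion of the homogeneous Sobolev space into the distributions. -/
def PreW11.toDistr (d : ℕ) : PreW11 d →ₗ[ℂ] Distr d := (w11 d).subtype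

theorem PreW11.pderiv_mem {d : ℕ} (j : Fin d) (u : PreW11 d) :
    pderiv j (PreW11.toDistr d u) ∈ LinearMap.range (ofL1 d) :=
  (Submodule.mem_iInf _).1 u.2 j

/-- The partial derivative `∂_j u` as an element of `L¹(ℝ^d)`. -/
def PreW11.grad {d : ℕ} (j : Fin d) : PreW11 d →ₗ[ℂ] (Rd d →₁[volume] ℂ) :=
  (LinearEquiv.ofInjective (ofL1 d) (ofL1_injective d)).symm.toLinearMap ∘ₗ
    ((pderiv j ∘ₗ PreW11.toDistr d).codRestrict (LinearMap.range (ofL1 d))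
      (PreW11.pderiv_mem j))

theorem PreW11.ofL1_grad {d : ℕ} (j : Fin d) (u : PreW11 d) :
    ofL1 d (PreW11.grad j u) = pderiv j (PreW11.toDistr d u) :=
  congrArg Subtype.val (LinearEquiv.apply_symm_apply
    (LinearEquiv.ofInjective (ofL1 d) (ofL1_injective d)) ⟨_, PreW11.pderiv_mem j u⟩)

/-- The seminorm `∑ j, ‖∂_j u‖_{L¹}`. -/
def PreW11.seminorm (d : ℕ) : Seminorm ℂ (PreW11 d) :=
  ∑ j : Fin d, (normSeminorm ℂ (Rd d →₁[volume] ℂ)).comp (PreW11.grad j)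

instance (d : ℕ) : SeminormedAddCommGroup (PreW11 d) :=
  (PreW11.seminorm d).toAddGroupSeminorm.toSeminormedAddCommGroup

theorem PreW11.norm_def {d : ℕ} (u : PreW11 d) : ‖u‖ = ∑ j : Fin d, ‖PreW11.grad j u‖ := by
  change PreW11.seminorm d u = _
  simp [PreW11.seminorm]

instance (d : ℕ) : NormedSpace ℂ (PreW11 d) where
  norm_smul_le c u := (map_smul_eq_mul (PreW11.seminorm d) c u).le

/-- The constant functions in the homogeneous Sobolev space (polynomials of degree `< 1`). -/
def constants (d : ℕ) : Submodule ℂ (PreW11 d) :=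
  (Submodule.span ℂ {ofFun (fun _ : Rd d => (1 : ℂ))}).comap (PreW11.toDistr d)

/-- The homogeneous Sobolev space `Ẇ¹₁(ℝ^d)`: distributions with integrable first order derivatives
modulo constants, with the quotient norm. -/
abbrev W11 (d : ℕ) : Type := PreW11 d ⧸ constants d

theorem schwartz_mem {d : ℕ} (f : 𝓢(Rd d, ℂ)) : ofFun f ∈ w11 d := by
  refine (Submodule.mem_iInf _).2 fun j => ?_
  set v : Rd d := EuclideanSpace.single j (1 : ℝ) with hv
  have hf : LocallyIntegrable f := f.integrable.locallyIntegrable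
  have hD : Integrable (∂_{v} f : 𝓢(Rd d, ℂ)) := (∂_{v} f : 𝓢(Rd d, ℂ)).integrable
  refine ⟨hD.toL1 _, ?_⟩
  ext φ
  change ofFun _ φ = (∂_{v} (ofFun f)) φ
  rw [Distribution.lineDerivOp_apply_apply, map_neg, ofFun_apply (L1_locallyIntegrable _),
    ofFun_apply hf]
  have h1 : ∫ x, φ x • (hD.toL1 _ : Rd d →₁[volume] ℂ) x = ∫ x, φ x • fderiv ℝ f x v := by
    refine integral_congr_ae ?_
    filter_upwards [hD.coeFn_toL1] with x hx
    rw [hx, SchwartzMap.lineDerivOp_apply_eq_fderiv]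
  have h2 : ∀ x, (∂_{v} φ : 𝓓((⊤ : Opens (Rd d)), ℝ)) x = fderiv ℝ φ x v := by
    intro x
    rw [TestFunction.lineDerivOp_eq_lineDerivCLM ℝ, TestFunction.lineDerivCLM_apply_of_le]
    · exact (φ.contDiff.differentiable (by simp) x).lineDeriv_eq_fderiv
    · simp
  rw [h1]
  simp_rw [h2]
  refine integral_smul_fderiv_eq_neg_fderiv_smul_of_integrable ?_ ?_ ?_ ?_ ?_
  · have := integrable_smul hf (∂_{v} φ)
    simpa only [h2] using this
  · have := integrable_smul hD.locallyIntegrable φ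
    simpa only [SchwartzMap.lineDerivOp_apply_eq_fderiv] using this
  · exact integrable_smul hf φ
  · exact fun x _ => φ.contDiff.differentiable (by simp) x
  · exact fun x _ => f.differentiable x

/-- The class in `Ẇ¹₁(ℝ^d)` of a Schwartz function. -/
def ofSchwartz {d : ℕ} (f : 𝓢(Rd d, ℂ)) : W11 d :=
  Submodule.Quotient.mk (⟨ofFun f, schwartz_mem f⟩ : PreW11 d)

/-- A real test function, regarded as a complex-valued Schwartz function. -/
def testToSchwartz {d : ℕ} (φ : 𝓓((⊤ : Opens (Rd d)), ℝ)) : 𝓢(Rd d, ℂ) :=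
  (φ.hasCompactSupport.comp_left (g := Complex.ofRealCLM) rfl).toSchwartzMap
    (Complex.ofRealCLM.contDiff.comp φ.contDiff)

/-- The tempered distribution `v` restricts to the distribution `u`. -/
def IsRestriction {d : ℕ} (u : Distr d) (v : 𝓢'(Rd d, ℂ)) : Prop :=
  ∀ φ : 𝓓((⊤ : Opens (Rd d)), ℝ), u φ = v (testToSchwartz φ)

/-- The tempered distribution `v` is given by the function `g`. -/
def IsGivenBy {d : ℕ} (v : 𝓢'(Rd d, ℂ)) (g : Rd d → ℂ) : Prop :=
  ∀ φ : 𝓢(Rd d, ℂ), Integrable (fun ξ => φ ξ * g ξ) ∧ v φ = ∫ ξ, φ ξ * g ξ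

/-- `m ∈ L^∞(ℝ^d)` is a Fourier multiplier on `Ẇ¹₁(ℝ^d)` with corresponding bounded operator `T`:
the Fourier transform of `T f` is `m` times the Fourier transform of `f`, for all Schwartz
functions `f`. As `T f` is a class modulo constants, this is the requirement that one of its
representatives is a tempered distribution with Fourier transform `m * 𝓕 f`. -/
def IsMultiplierWith {d : ℕ} (m : Rd d → ℂ) (T : W11 d →L[ℂ] W11 d) : Prop :=
  MemLp m (⊤ : ℝ≥0∞) volume ∧
    ∀ f : 𝓢(Rd d, ℂ), ∃ (u : PreW11 d) (v : 𝓢'(Rd d, ℂ)),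
      T (ofSchwartz f) = Submodule.Quotient.mk u ∧ IsRestriction (PreW11.toDistr d u) v ∧
        IsGivenBy (𝓕 v) (fun ξ => m ξ * 𝓕 f ξ)

/-- `m` is a Fourier multiplier on `Ẇ¹₁(ℝ^d)`. -/
def IsMultiplier {d : ℕ} (m : Rd d → ℂ) : Prop :=
  ∃ T : W11 d →L[ℂ] W11 d, IsMultiplierWith m T

end HomSobolev

end

/-!
The gradient identifies `Ẇ¹₁(ℝ^d)` isometrically with the curl-free `L¹` vector fields: a curl-free
field `h` is the gradient of `Δ⁻¹ div h`, whose Fourier transform is `O(1 / ‖ξ‖)` and therefore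
defines a tempered distribution up to a constant.

If `m` is the symbol of `T`, testing `T` on a Schwartz function whose Fourier transform equals `1`
on the shell `r ≤ ‖ξ‖ ≤ 2r` bounds `r * |m|` on that shell by `‖T‖` times the norm of the function.
Such functions are dilates of a single one, with norm proportional to `r`, so `|m|` is bounded by a
multiple of `‖T‖`. Hence the `m_k` are uniformly bounded, and dominated convergence gives
`𝓕⁻ (m_k * 𝓕 (∂_j f)) → 𝓕⁻ (m * 𝓕 (∂_j f))` pointwise; by Fatou's lemma the uniform `L¹` bounds
pass to the limit.

It remains to extend the limit operator from Schwartz functions to all of `Ẇ¹₁(ℝ^d)`. Gradients of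
Schwartz functions are dense in the curl-free fields with mean zero: cut the frequencies of `h` to
an annulus and let the annulus exhaust `ℝ^d \ {0}`; the low frequencies that are removed tend to
zero in `L¹` because `h` has mean zero. As the mean zero fields have finite codimension, they are
the range of a bounded projection, along which the operator is extended.
-/

noncomputable section

open MeasureTheory TopologicalSpace Filter
open scoped Distributions SchwartzMap FourierTransform LineDeriv ENNReal ContDiff Topology

namespace HomSobolev

section Fourier

variable {V : Type*} [NormedAddCommGroup V] [InnerProductSpace ℝ V]

/-- The Fourier symbol `ξ ↦ 2πi⟪ξ, v⟫` of the derivative `∂_v`. -/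
def derivSymbol (v ξ : V) : ℂ := 2 * Real.pi * Complex.I * (inner ℝ ξ v : ℝ)

theorem derivSymbol_zero (v : V) : derivSymbol v 0 = 0 := by
  simp [derivSymbol]

theorem norm_derivSymbol (v ξ : V) : ‖derivSymbol v ξ‖ = 2 * Real.pi * |inner ℝ ξ v| := by
  simp [derivSymbol, abs_of_pos Real.pi_pos]

theorem continuous_derivSymbol (v : V) : Continuous (derivSymbol v) := by
  unfold derivSymbol
  fun_prop

variable [FiniteDimensional ℝ V] [MeasurableSpace V] [BorelSpace V]

/-- The value at `ξ` of the Fourier transform, as a bounded functional on `L¹`. -/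
def fourierAt (ξ : V) : (V →₁[volume] ℂ) →L[ℂ] ℂ :=
  BoundedContinuousFunction.evalCLM ℂ ξ ∘L Real.Lp.fourierTransformCLM V ℂ

theorem fourierAt_apply (ξ : V) (g : V →₁[volume] ℂ) : fourierAt ξ g = 𝓕 (g : V → ℂ) ξ := rfl

theorem norm_fourierAt_le (ξ : V) (g : V →₁[volume] ℂ) : ‖fourierAt ξ g‖ ≤ ‖g‖ := by
  rw [L1.norm_eq_integral_norm]
  exact VectorFourier.norm_fourierIntegral_le_integral_norm Real.fourierChar volume (innerₗ V) g ξ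

theorem fourierAt_toLp (ξ : V) (f : 𝓢(V, ℂ)) : fourierAt ξ (f.toLp 1) = 𝓕 f ξ := by
  rw [fourierAt_apply, Real.fourier_congr_ae (f.coeFn_toLp 1 volume), SchwartzMap.fourier_coe]

theorem fourier_zero (g : V → ℂ) : 𝓕 g 0 = ∫ x, g x := by
  simp [Real.fourier_eq]

theorem continuous_fourier {g : V → ℂ} (hg : Integrable g) : Continuous (𝓕 g) :=
  VectorFourier.fourierIntegral_continuous Real.continuous_fourierChar
    (by exact continuous_inner) hg

theorem continuous_fourierInv {g : V → ℂ} (hg : Integrable g) : Continuous (𝓕⁻ g) := by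
  rw [Real.fourierInv_eq_fourier_comp_neg]
  exact continuous_fourier hg.comp_neg

theorem integral_fourier_mul {f g : V → ℂ} (hf : Integrable f) (hg : Integrable g) :
    ∫ ξ, 𝓕 f ξ * g ξ = ∫ x, f x * 𝓕 g x := by
  have := VectorFourier.integral_fourierIntegral_smul_eq_flip (L := innerₗ V)
    (μ := volume) (ν := volume) Real.continuous_fourierChar continuous_inner hf hg
  rwa [flip_innerₗ] at this

theorem integral_fourierInv_mul {f g : V → ℂ} (hf : Integrable f) (hg : Integrable g) :
    ∫ ξ, 𝓕⁻ f ξ * g ξ = ∫ x, f x * 𝓕⁻ g x := by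
  calc ∫ ξ, 𝓕⁻ f ξ * g ξ = ∫ ξ, 𝓕 f ξ * g (-ξ) := by
        rw [← integral_neg_eq_self]
        simp only [Real.fourierInv_eq_fourier_neg, neg_neg]
    _ = ∫ x, f x * 𝓕⁻ g x := by
        rw [integral_fourier_mul hf hg.comp_neg, Real.fourierInv_eq_fourier_comp_neg]

theorem ae_eq_of_integral_schwartz_mul_eq {f g : V → ℂ} (hf : LocallyIntegrable f)
    (hg : LocallyIntegrable g) (h : ∀ φ : 𝓢(V, ℂ), ∫ x, φ x * f x = ∫ x, φ x * g x) :
    f =ᵐ[volume] g := by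
  refine ae_eq_of_integral_contDiff_smul_eq hf hg fun φ hφ hc => ?_
  simpa using! h ((hc.comp_left (g := Complex.ofRealCLM) rfl).toSchwartzMap
    (Complex.ofRealCLM.contDiff.comp hφ))

theorem fourier_ae_eq_of_ae_eq_fourierInv {h g : V → ℂ} (hh : Integrable h) (hg : Integrable g)
    (e : h =ᵐ[volume] 𝓕⁻ g) : 𝓕 h =ᵐ[volume] g := by
  refine ae_eq_of_integral_schwartz_mul_eq (continuous_fourier hh).locallyIntegrable
    hg.locallyIntegrable fun φ => ?_
  calc ∫ ξ, φ ξ * 𝓕 h ξ = ∫ x, 𝓕 φ x * h x := (integral_fourier_mul φ.integrable hh).symm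
    _ = ∫ x, 𝓕 φ x * 𝓕⁻ g x := integral_congr_ae <| by
        filter_upwards [e] with x hx
        rw [hx]
    _ = ∫ ξ, φ ξ * g ξ := by
        rw [← integral_fourierInv_mul (𝓕 φ).integrable hg, ← SchwartzMap.fourierInv_coe,
          FourierTransform.fourierInv_fourier_eq]

theorem ae_eq_of_fourier_eq {f g : V → ℂ} (hf : Integrable f) (hg : Integrable g)
    (h : 𝓕 f = 𝓕 g) : f =ᵐ[volume] g := by
  have hpairing {k : V → ℂ} (hk : Integrable k) (φ : 𝓢(V, ℂ)) :
      ∫ x, φ x * k x = ∫ x, 𝓕⁻ φ x * 𝓕 k x := by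
    rw [← integral_fourier_mul (𝓕⁻ φ).integrable hk, ← SchwartzMap.fourier_coe,
      FourierTransform.fourier_fourierInv_eq]
  refine ae_eq_of_integral_schwartz_mul_eq hf.locallyIntegrable hg.locallyIntegrable fun φ => ?_
  rw [hpairing hf, hpairing hg, h]

theorem ext_fourierAt {f g : V →₁[volume] ℂ} (h : ∀ ξ, fourierAt ξ f = fourierAt ξ g) : f = g :=
  Lp.ext (ae_eq_of_fourier_eq (L1.integrable_coeFn f) (L1.integrable_coeFn g) (funext h))

theorem integrable_schwartz_mul {g : V → ℂ} (hg : Integrable g) (φ : 𝓢(V, ℂ)) :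
    Integrable fun ξ => φ ξ * g ξ :=
  hg.bdd_mul φ.continuous.aestronglyMeasurable
    (ae_of_all _ fun x => SchwartzMap.norm_le_seminorm ℝ φ x)

theorem integrable_mul_schwartz {m : V → ℂ} (hm : MemLp m ∞ volume) (f : 𝓢(V, ℂ)) :
    Integrable fun ξ => m ξ * f ξ :=
  f.integrable.mul_of_top_right hm

theorem fourier_lineDerivOp_apply (φ : 𝓢(V, ℂ)) (v ξ : V) :
    𝓕 (∂_{v} φ : 𝓢(V, ℂ)) ξ = derivSymbol v ξ * 𝓕 φ ξ := by
  have : (fun x : V => inner ℝ x v).HasTemperateGrowth := by fun_prop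
  rw [SchwartzMap.fourier_lineDerivOp_eq, smul_apply, SchwartzMap.smulLeftCLM_apply_apply this]
  simp [derivSymbol, mul_assoc]

theorem fourierInv_lineDerivOp_apply (φ : 𝓢(V, ℂ)) (v ξ : V) :
    𝓕⁻ (∂_{v} φ : 𝓢(V, ℂ)) ξ = -(derivSymbol v ξ * 𝓕⁻ φ ξ) := by
  have : (fun x : V => inner ℝ x v).HasTemperateGrowth := by fun_prop
  rw [SchwartzMap.fourierInv_lineDerivOp_eq, smul_apply, SchwartzMap.smulLeftCLM_apply_apply this]
  simp [derivSymbol, mul_assoc]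

theorem integral_lineDerivOp (φ : 𝓢(V, ℂ)) (v : V) : ∫ x, (∂_{v} φ : 𝓢(V, ℂ)) x = 0 := by
  rw [← fourier_zero, ← SchwartzMap.fourier_coe, fourier_lineDerivOp_apply, derivSymbol_zero,
    zero_mul]

theorem lineDerivOp_comm (f : 𝓢(V, ℂ)) (v w : V) : ∂_{v} (∂_{w} f) = ∂_{w} (∂_{v} f) := by
  have h : (𝓕 (∂_{v} (∂_{w} f) : 𝓢(V, ℂ)) : 𝓢(V, ℂ)) = 𝓕 (∂_{w} (∂_{v} f) : 𝓢(V, ℂ)) := by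
    ext ξ
    simp only [fourier_lineDerivOp_apply]
    ring
  simpa only [FourierTransform.fourierInv_fourier_eq] using
    congrArg (fun g : 𝓢(V, ℂ) => (𝓕⁻ g : 𝓢(V, ℂ))) h

section Limits

variable {g : ℕ → V → ℂ} {g₀ : V → ℂ} {bound : V → ℝ}

theorem tendsto_fourierInv_of_dominated (hg : ∀ k, AEStronglyMeasurable (g k))
    (hbound : Integrable bound) (hle : ∀ k, ∀ᵐ ξ, ‖g k ξ‖ ≤ bound ξ)
    (hlim : ∀ᵐ ξ, Tendsto (g · ξ) atTop (𝓝 (g₀ ξ))) (x : V) :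
    Tendsto (fun k => 𝓕⁻ (g k) x) atTop (𝓝 (𝓕⁻ g₀ x)) := by
  simp only [Real.fourierInv_eq]
  refine tendsto_integral_of_dominated_convergence bound (fun k => ?_) hbound (fun k => ?_) ?_
  · exact (Real.continuous_fourierChar.comp (by fun_prop)).aestronglyMeasurable.smul (hg k)
  · simpa only [Circle.norm_smul] using hle k
  · filter_upwards [hlim] with ξ hξ
    exact hξ.const_smul _

theorem eLpNorm_fourierInv_le (hg : ∀ k, AEStronglyMeasurable (g k))
    (hbound : Integrable bound) (hle : ∀ k, ∀ᵐ ξ, ‖g k ξ‖ ≤ bound ξ)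
    (hlim : ∀ᵐ ξ, Tendsto (g · ξ) atTop (𝓝 (g₀ ξ))) {p C : ℝ≥0∞}
    (hC : ∀ k, eLpNorm (𝓕⁻ (g k)) p volume ≤ C) : eLpNorm (𝓕⁻ g₀) p volume ≤ C := by
  have hcont (k : ℕ) : Continuous (𝓕⁻ (g k)) :=
    continuous_fourierInv (hbound.mono' (hg k) (hle k))
  calc eLpNorm (𝓕⁻ g₀) p volume ≤ liminf (fun k => eLpNorm (𝓕⁻ (g k)) p volume) atTop :=
        Lp.eLpNorm_lim_le_liminf_eLpNorm (fun k => (hcont k).aestronglyMeasurable) _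
          (ae_of_all _ (tendsto_fourierInv_of_dominated hg hbound hle hlim))
    _ ≤ C := liminf_le_of_frequently_le' (Frequently.of_forall hC)

end Limits

end Fourier

section Dilation

variable {V : Type*} [NormedAddCommGroup V] [InnerProductSpace ℝ V] [FiniteDimensional ℝ V]

/-- The dilation `x ↦ r ^ dim V * f (r x)`, normalised to preserve integrals. -/
def dilate {r : ℝ} (hr : 0 < r) : 𝓢(V, ℂ) →L[ℂ] 𝓢(V, ℂ) :=
  ((r : ℂ) ^ Module.finrank ℝ V) • SchwartzMap.compCLMOfContinuousLinearEquiv ℂ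
    (LinearEquiv.smulOfNeZero ℝ V r hr.ne').toContinuousLinearEquiv

theorem dilate_apply {r : ℝ} (hr : 0 < r) (f : 𝓢(V, ℂ)) (x : V) :
    dilate hr f x = (r : ℂ) ^ Module.finrank ℝ V * f (r • x) := rfl

theorem norm_dilate_apply {r : ℝ} (hr : 0 < r) (f : 𝓢(V, ℂ)) (x : V) :
    ‖dilate hr f x‖ = r ^ Module.finrank ℝ V * ‖f (r • x)‖ := by
  rw [dilate_apply, norm_mul, norm_pow, Complex.norm_of_nonneg hr.le]

theorem lineDerivOp_dilate {r : ℝ} (hr : 0 < r) (f : 𝓢(V, ℂ)) (v : V) :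
    ∂_{v} (dilate hr f) = r • dilate hr (∂_{v} f) := by
  ext x
  have h : HasFDerivAt (dilate hr f) (((r : ℂ) ^ Module.finrank ℝ V) •
      (fderiv ℝ f (r • x)).comp (r • ContinuousLinearMap.id ℝ V)) x :=
    (f.differentiableAt.hasFDerivAt.comp x ((hasFDerivAt_id x).const_smul r)).const_mul _
  rw [SchwartzMap.lineDerivOp_apply_eq_fderiv, h.fderiv]
  simp [dilate_apply, SchwartzMap.lineDerivOp_apply_eq_fderiv, mul_left_comm]

variable [MeasurableSpace V] [BorelSpace V]

theorem integral_pow_finrank_smul_comp_smul {E : Type*} [NormedAddCommGroup E] [NormedSpace ℝ E]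
    {r : ℝ} (hr : 0 < r) (g : V → E) :
    ∫ x, (r ^ Module.finrank ℝ V) • g (r • x) = ∫ x, g x := by
  rw [integral_smul, Measure.integral_comp_smul, abs_of_pos (by positivity),
    smul_inv_smul₀ (by positivity)]

theorem fourier_dilate {r : ℝ} (hr : 0 < r) (f : 𝓢(V, ℂ)) (ξ : V) :
    𝓕 (dilate hr f) ξ = 𝓕 f (r⁻¹ • ξ) := by
  rw [SchwartzMap.fourier_coe, SchwartzMap.fourier_coe, Real.fourier_eq, Real.fourier_eq,
    ← integral_pow_finrank_smul_comp_smul hr fun x => Real.fourierChar (-inner ℝ x (r⁻¹ • ξ)) • f x]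
  congr with x
  rw [dilate_apply, inner_smul_right, inner_smul_left, RCLike.conj_to_real,
    inv_mul_cancel_left₀ hr.ne', ← smul_eq_mul, ← Complex.ofReal_pow, Complex.coe_smul,
    smul_comm]

theorem norm_toLp_dilate {r : ℝ} (hr : 0 < r) (f : 𝓢(V, ℂ)) :
    ‖(dilate hr f).toLp 1‖ = ‖f.toLp 1‖ := by
  simp only [SchwartzMap.norm_toLp_one, norm_dilate_apply]
  exact integral_pow_finrank_smul_comp_smul hr fun x => ‖f x‖

end Dilation

section Cutoff

variable (V : Type*) [NormedAddCommGroup V] [InnerProductSpace ℝ V] [FiniteDimensional ℝ V]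

/-- A smooth cutoff, equal to `1` on the ball of radius `2` and vanishing outside the ball of
radius `3`. -/
def cutoff : 𝓢(V, ℂ) :=
  let b : ContDiffBump (0 : V) := ⟨2, 3, by norm_num, by norm_num⟩
  (b.hasCompactSupport.comp_left (g := Complex.ofRealCLM) rfl).toSchwartzMap
    (Complex.ofRealCLM.contDiff.comp b.contDiff)

variable {V}

theorem cutoff_eq_one {ξ : V} (h : ‖ξ‖ ≤ 2) : cutoff V ξ = 1 :=
  congrArg Complex.ofReal (ContDiffBump.one_of_mem_closedBall _ (by simpa using! h))

theorem cutoff_eq_zero {ξ : V} (h : 3 ≤ ‖ξ‖) : cutoff V ξ = 0 :=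
  congrArg Complex.ofReal (ContDiffBump.zero_of_le_dist _ (by simpa using! h))

theorem cutoff_inv_smul_eq_one {r : ℝ} (hr : 0 < r) {ξ : V} (h : ‖ξ‖ ≤ 2 * r) :
    cutoff V (r⁻¹ • ξ) = 1 := by
  refine cutoff_eq_one ?_
  rwa [norm_smul, norm_inv, Real.norm_of_nonneg hr.le, inv_mul_eq_div, div_le_iff₀ hr]

theorem cutoff_inv_smul_eq_zero {r : ℝ} (hr : 0 < r) {ξ : V} (h : 3 * r ≤ ‖ξ‖) :
    cutoff V (r⁻¹ • ξ) = 0 := by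
  refine cutoff_eq_zero ?_
  rwa [norm_smul, norm_inv, Real.norm_of_nonneg hr.le, inv_mul_eq_div, le_div_iff₀ hr]

variable [MeasurableSpace V] [BorelSpace V]

variable (V) in
/-- The kernel of the low-pass filter at unit frequency: its Fourier transform is `cutoff`. -/
def lowPass : 𝓢(V, ℂ) := 𝓕⁻ (cutoff V)

theorem fourier_dilate_lowPass {r : ℝ} (hr : 0 < r) (ξ : V) :
    𝓕 (dilate hr (lowPass V)) ξ = cutoff V (r⁻¹ • ξ) := by
  rw [fourier_dilate, lowPass, FourierTransform.fourier_fourierInv_eq]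

end Cutoff

section Distributions

variable {d : ℕ}

/-- The `j`-th vector of the standard basis of `ℝ^d`. -/
abbrev stdVec (j : Fin d) : Rd d := EuclideanSpace.single j (1 : ℝ)

theorem lineDerivOp_testFunction_apply (φ : 𝓓((⊤ : Opens (Rd d)), ℝ)) (v x : Rd d) :
    (∂_{v} φ : 𝓓((⊤ : Opens (Rd d)), ℝ)) x = fderiv ℝ φ x v := by
  rw [TestFunction.lineDerivOp_eq_lineDerivCLM ℝ, TestFunction.lineDerivCLM_apply_of_le (by simp)]
  exact (φ.contDiff.differentiable (by simp) x).lineDeriv_eq_fderiv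

theorem testToSchwartz_apply (φ : 𝓓((⊤ : Opens (Rd d)), ℝ)) (x : Rd d) :
    testToSchwartz φ x = (φ x : ℂ) := rfl

theorem testToSchwartz_injective : Function.Injective (testToSchwartz (d := d)) := by
  intro φ ψ h
  ext x
  exact Complex.ofReal_injective (congrArg (fun f : 𝓢(Rd d, ℂ) => f x) h)

theorem testToSchwartz_lineDerivOp (φ : 𝓓((⊤ : Opens (Rd d)), ℝ)) (v : Rd d) :
    testToSchwartz (∂_{v} φ) = ∂_{v} (testToSchwartz φ) := by
  ext x
  have h : HasFDerivAt (testToSchwartz φ) (Complex.ofRealCLM.comp (fderiv ℝ φ x)) x :=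
    Complex.ofRealCLM.hasFDerivAt.comp x (φ.contDiff.differentiable (by simp) x).hasFDerivAt
  rw [testToSchwartz_apply, lineDerivOp_testFunction_apply,
    SchwartzMap.lineDerivOp_apply_eq_fderiv, h.fderiv]
  rfl

theorem pderiv_apply (j : Fin d) (u : Distr d) (φ : 𝓓((⊤ : Opens (Rd d)), ℝ)) :
    pderiv j u φ = -u (∂_{stdVec j} φ) := by
  change (∂_{stdVec j} u) φ = _
  rw [Distribution.lineDerivOp_apply_apply, map_neg]

theorem ofFun_apply_eq_integral_mul {g : Rd d → ℂ} (hg : LocallyIntegrable g)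
    (φ : 𝓓((⊤ : Opens (Rd d)), ℝ)) : ofFun g φ = ∫ x, testToSchwartz φ x * g x := by
  rw [ofFun_apply hg]
  rfl

theorem ofFun_fourierInv_apply {g : Rd d → ℂ} (hg : Integrable g)
    (φ : 𝓓((⊤ : Opens (Rd d)), ℝ)) :
    ofFun (𝓕⁻ g) φ = ∫ ξ, 𝓕⁻ (testToSchwartz φ) ξ * g ξ := by
  rw [ofFun_apply_eq_integral_mul (continuous_fourierInv hg).locallyIntegrable,
    ← integral_fourierInv_mul (testToSchwartz φ).integrable hg, SchwartzMap.fourierInv_coe]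

theorem ofFun_fourierInv_fourier (f : 𝓢(Rd d, ℂ)) :
    ofFun (𝓕⁻ fun ξ => 𝓕 f ξ) = ofFun f := by
  rw [← SchwartzMap.fourierInv_coe, FourierTransform.fourierInv_fourier_eq]

theorem ae_eq_of_ofFun_eq {f g : Rd d → ℂ} (hf : LocallyIntegrable f) (hg : LocallyIntegrable g)
    (h : ofFun f = ofFun g) : f =ᵐ[volume] g := by
  refine ae_eq_of_integral_contDiff_smul_eq hf hg fun φ hφ hc => ?_
  have := congrArg (fun u : Distr d => u ⟨φ, hφ, hc, fun _ _ => trivial⟩) h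
  rwa [ofFun_apply hf, ofFun_apply hg] at this

theorem pderiv_ofFun_fourierInv (j : Fin d) {g : Rd d → ℂ} (hg : Integrable g)
    (hg' : Integrable fun ξ => derivSymbol (stdVec j) ξ * g ξ) :
    pderiv j (ofFun (𝓕⁻ g)) = ofFun (𝓕⁻ fun ξ => derivSymbol (stdVec j) ξ * g ξ) := by
  ext φ
  rw [pderiv_apply, ofFun_fourierInv_apply hg, ofFun_fourierInv_apply hg',
    testToSchwartz_lineDerivOp, ← integral_neg]
  congr with ξ
  rw [fourierInv_lineDerivOp_apply]
  ring

theorem pderiv_ofFun_one (j : Fin d) : pderiv j (ofFun fun _ : Rd d => (1 : ℂ)) = 0 := by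
  ext φ
  rw [pderiv_apply, ofFun_apply_eq_integral_mul continuous_const.locallyIntegrable,
    testToSchwartz_lineDerivOp]
  simp [integral_lineDerivOp]

theorem eq_ofFun_fourierInv_of_isRestriction {u : Distr d} {v : 𝓢'(Rd d, ℂ)} {g : Rd d → ℂ}
    (hg : Integrable g) (huv : IsRestriction u v) (hv : IsGivenBy (𝓕 v) g) :
    u = ofFun (𝓕⁻ g) := by
  ext φ
  rw [ofFun_fourierInv_apply hg, huv φ, ← (hv (𝓕⁻ (testToSchwartz φ))).2,
    TemperedDistribution.fourier_apply, FourierTransform.fourier_fourierInv_eq]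

theorem exists_isRestriction_isGivenBy {g : Rd d → ℂ} (hg : Integrable g) :
    ∃ v : 𝓢'(Rd d, ℂ), IsRestriction (ofFun (𝓕⁻ g)) v ∧ IsGivenBy (𝓕 v) g := by
  have hpairing (φ : 𝓢(Rd d, ℂ)) : Lp.toTemperedDistribution (hg.toL1 g) φ = ∫ ξ, φ ξ * g ξ := by
    rw [Lp.toTemperedDistribution_apply]
    refine integral_congr_ae ?_
    filter_upwards [hg.coeFn_toL1] with x hx
    rw [hx, smul_eq_mul]
  refine ⟨𝓕⁻ (Lp.toTemperedDistribution (hg.toL1 g)), fun φ => ?_, fun φ => ?_⟩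
  · rw [TemperedDistribution.fourierInv_apply, hpairing, ofFun_fourierInv_apply hg]
  · rw [FourierTransform.fourier_fourierInv_eq]
    exact ⟨integrable_schwartz_mul hg φ, hpairing φ⟩

end Distributions

section Gradient

variable {d : ℕ}

theorem grad_eq_zero_of_mem_constants (j : Fin d) {c : PreW11 d} (hc : c ∈ constants d) :
    PreW11.grad j c = 0 := by
  apply ofL1_injective d
  obtain ⟨a, ha⟩ := Submodule.mem_span_singleton.1 (Submodule.mem_comap.1 hc)
  rw [PreW11.ofL1_grad, ← ha, map_zero]
  exact LinearMap.mem_ker.1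
    ((LinearMap.ker (pderiv j)).smul_mem a (LinearMap.mem_ker.2 (pderiv_ofFun_one j)))

theorem norm_mk_eq (u : PreW11 d) : ‖(Submodule.Quotient.mk u : W11 d)‖ = ‖u‖ := by
  refine le_antisymm (Submodule.Quotient.norm_mk_le _ _) (le_of_forall_pos_le_add fun ε hε => ?_)
  obtain ⟨u', hu', hlt⟩ := Submodule.Quotient.norm_mk_lt (Submodule.Quotient.mk u : W11 d) hε
  have hgrad (j : Fin d) : PreW11.grad j u' = PreW11.grad j u := by
    rw [← sub_eq_zero, ← map_sub]
    exact grad_eq_zero_of_mem_constants j ((Submodule.Quotient.eq _).1 hu')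
  rw [PreW11.norm_def] at hlt ⊢
  simpa only [hgrad] using hlt.le

/-- The gradient, which is isometric because constants have zero gradient. -/
def gradient (d : ℕ) : W11 d →ₗᵢ[ℂ] PiLp 1 fun _ : Fin d => Rd d →₁[volume] ℂ where
  toLinearMap := (constants d).liftQ
    ((WithLp.linearEquiv 1 ℂ _).symm.toLinearMap ∘ₗ LinearMap.pi PreW11.grad) fun c hc => by
      refine LinearMap.mem_ker.2 (PiLp.ext fun j => ?_)
      exact grad_eq_zero_of_mem_constants j hc
  norm_map' q := by
    obtain ⟨u, rfl⟩ := Submodule.Quotient.mk_surjective _ q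
    rw [norm_mk_eq, PreW11.norm_def]
    exact PiLp.norm_eq_of_L1 _

theorem norm_eq_sum_gradient (q : W11 d) : ‖q‖ = ∑ j, ‖gradient d q j‖ := by
  rw [← (gradient d).norm_map, PiLp.norm_eq_of_L1]

end Gradient

section Multiplier

variable {d : ℕ} {m : Rd d → ℂ}

/-- The tempered distribution `𝓕⁻ (m * 𝓕 f)`, restricted to test functions, as a linear function of
the Schwartz function `f`. -/
def multiplierDistr (hm : MemLp m ∞ volume) : 𝓢(Rd d, ℂ) →ₗ[ℂ] Distr d where
  toFun f := ofFun (𝓕⁻ fun ξ => m ξ * 𝓕 f ξ)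
  map_add' f g := by
    ext φ
    have hint (f : 𝓢(Rd d, ℂ)) :=
      integrable_schwartz_mul (integrable_mul_schwartz hm (𝓕 f)) (𝓕⁻ (testToSchwartz φ))
    rw [add_apply]
    simp only [ofFun_fourierInv_apply (integrable_mul_schwartz hm _)]
    rw [← integral_add (hint f) (hint g)]
    simp only [FourierTransform.fourier_add, add_apply, mul_add]
  map_smul' c f := by
    ext φ
    change _ = c • ofFun _ φ
    simp only [ofFun_fourierInv_apply (integrable_mul_schwartz hm _)]
    rw [← integral_smul]
    simp only [FourierTransform.fourier_smul, smul_apply, smul_eq_mul, mul_left_comm]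

theorem multiplierDistr_apply (hm : MemLp m ∞ volume) (f : 𝓢(Rd d, ℂ)) :
    multiplierDistr hm f = ofFun (𝓕⁻ fun ξ => m ξ * 𝓕 f ξ) := rfl

theorem isMultiplierWith_iff {T : W11 d →L[ℂ] W11 d} :
    IsMultiplierWith m T ↔ ∃ hm : MemLp m ∞ volume, ∀ f : 𝓢(Rd d, ℂ), ∃ u : PreW11 d,
      PreW11.toDistr d u = multiplierDistr hm f ∧
        T (ofSchwartz f) = Submodule.Quotient.mk u := by
  constructor
  · rintro ⟨hm, h⟩
    refine ⟨hm, fun f => ?_⟩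
    obtain ⟨u, v, hTu, huv, hv⟩ := h f
    exact ⟨u, eq_ofFun_fourierInv_of_isRestriction (integrable_mul_schwartz hm _) huv hv, hTu⟩
  · rintro ⟨hm, h⟩
    refine ⟨hm, fun f => ?_⟩
    obtain ⟨u, hu, hTu⟩ := h f
    obtain ⟨v, hv, hv'⟩ := exists_isRestriction_isGivenBy (integrable_mul_schwartz hm (𝓕 f))
    exact ⟨u, v, hTu, by rwa [hu], hv'⟩

theorem derivSymbol_mul_mul_fourier (m : Rd d → ℂ) (f : 𝓢(Rd d, ℂ)) (v : Rd d) :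
    (fun ξ => derivSymbol v ξ * (m ξ * 𝓕 f ξ)) = fun ξ => m ξ * 𝓕 (∂_{v} f : 𝓢(Rd d, ℂ)) ξ := by
  ext ξ
  rw [fourier_lineDerivOp_apply, mul_left_comm]

theorem integrable_derivSymbol_mul (hm : MemLp m ∞ volume) (f : 𝓢(Rd d, ℂ)) (v : Rd d) :
    Integrable fun ξ => derivSymbol v ξ * (m ξ * 𝓕 f ξ) := by
  rw [derivSymbol_mul_mul_fourier]
  exact integrable_mul_schwartz hm _

theorem pderiv_multiplierDistr (hm : MemLp m ∞ volume) (f : 𝓢(Rd d, ℂ)) (j : Fin d) :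
    pderiv j (multiplierDistr hm f) = multiplierDistr hm (∂_{stdVec j} f) := by
  rw [multiplierDistr_apply, multiplierDistr_apply, ← derivSymbol_mul_mul_fourier]
  exact pderiv_ofFun_fourierInv j (integrable_mul_schwartz hm _)
    (integrable_derivSymbol_mul hm f _)

theorem grad_ae_eq_of_toDistr_eq {hm : MemLp m ∞ volume} {f : 𝓢(Rd d, ℂ)} {u : PreW11 d}
    (hu : PreW11.toDistr d u = multiplierDistr hm f) (j : Fin d) :
    PreW11.grad j u =ᵐ[volume] 𝓕⁻ fun ξ => m ξ * 𝓕 (∂_{stdVec j} f : 𝓢(Rd d, ℂ)) ξ := by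
  refine ae_eq_of_ofFun_eq (L1_locallyIntegrable _)
    (continuous_fourierInv (integrable_mul_schwartz hm _)).locallyIntegrable ?_
  rw [← multiplierDistr_apply hm, ← pderiv_multiplierDistr, ← hu, ← PreW11.ofL1_grad]
  rfl

theorem fourierAt_grad_ae_eq {hm : MemLp m ∞ volume} {f : 𝓢(Rd d, ℂ)} {u : PreW11 d}
    (hu : PreW11.toDistr d u = multiplierDistr hm f) (j : Fin d) :
    ∀ᵐ ξ, fourierAt ξ (PreW11.grad j u) = derivSymbol (stdVec j) ξ * (m ξ * 𝓕 f ξ) := by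
  filter_upwards [fourier_ae_eq_of_ae_eq_fourierInv (L1.integrable_coeFn _)
    (integrable_mul_schwartz hm _) (grad_ae_eq_of_toDistr_eq hu j)] with ξ hξ
  rw [fourierAt_apply, hξ, fourier_lineDerivOp_apply, mul_left_comm]

theorem ofFun_eq_multiplierDistr_one (f : 𝓢(Rd d, ℂ)) :
    ofFun f = multiplierDistr (memLp_top_const (1 : ℂ)) f := by
  simp only [multiplierDistr_apply, one_mul, ofFun_fourierInv_fourier]

theorem gradient_ofSchwartz (f : 𝓢(Rd d, ℂ)) (j : Fin d) :
    gradient d (ofSchwartz f) j = (∂_{stdVec j} f : 𝓢(Rd d, ℂ)).toLp 1 := by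
  have h := grad_ae_eq_of_toDistr_eq (u := ⟨ofFun f, schwartz_mem f⟩)
    (ofFun_eq_multiplierDistr_one f) j
  simp only [one_mul] at h
  rw [← SchwartzMap.fourierInv_coe, FourierTransform.fourierInv_fourier_eq] at h
  exact Lp.ext (h.trans (SchwartzMap.coeFn_toLp _ _ _).symm)

theorem ofFun_congr_ae {f g : Rd d → ℂ} (hf : LocallyIntegrable f) (hg : LocallyIntegrable g)
    (h : f =ᵐ[volume] g) : ofFun f = ofFun g := by
  ext φ
  rw [ofFun_apply hf, ofFun_apply hg]
  refine integral_congr_ae ?_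
  filter_upwards [h] with x hx
  rw [hx]

theorem multiplierDistr_mem_w11 (hm : MemLp m ∞ volume) (f : 𝓢(Rd d, ℂ))
    (h : ∀ j : Fin d, Integrable (𝓕⁻ fun ξ => m ξ * 𝓕 (∂_{stdVec j} f : 𝓢(Rd d, ℂ)) ξ)) :
    multiplierDistr hm f ∈ w11 d := by
  refine (Submodule.mem_iInf _).2 fun j => ⟨(h j).toL1 _, ?_⟩
  rw [pderiv_multiplierDistr]
  exact ofFun_congr_ae (L1_locallyIntegrable _) (h j).locallyIntegrable (h j).coeFn_toL1

end Multiplier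

section MultiplierBound

variable {d : ℕ} {m : Rd d → ℂ} {T : W11 d →L[ℂ] W11 d}

theorem norm_le_sum_norm_derivSymbol (ξ : Rd d) :
    ‖ξ‖ ≤ ∑ j : Fin d, ‖derivSymbol (stdVec j) ξ‖ := by
  calc ‖ξ‖ = ‖∑ j, ξ j • EuclideanSpace.basisFun (Fin d) ℝ j‖ := by
        congr 1
        simpa using! ((EuclideanSpace.basisFun (Fin d) ℝ).sum_repr ξ).symm
    _ ≤ ∑ j, ‖ξ j • EuclideanSpace.basisFun (Fin d) ℝ j‖ := norm_sum_le _ _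
    _ = ∑ j, |ξ j| := by simp [norm_smul]
    _ ≤ ∑ j : Fin d, ‖derivSymbol (stdVec j) ξ‖ := by
        refine Finset.sum_le_sum fun j _ => ?_
        rw [norm_derivSymbol, EuclideanSpace.inner_single_right]
        refine le_mul_of_one_le_left (abs_nonneg _) ?_ |>.trans_eq' (by simp)
        linarith [Real.pi_gt_three]

theorem norm_ofSchwartz_dilate {r : ℝ} (hr : 0 < r) (f : 𝓢(Rd d, ℂ)) :
    ‖ofSchwartz (dilate hr f)‖ = r * ‖ofSchwartz f‖ := by
  simp only [norm_eq_sum_gradient, gradient_ofSchwartz, lineDerivOp_dilate, Finset.mul_sum]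
  refine Finset.sum_congr rfl fun j _ => ?_
  rw [← SchwartzMap.toLpCLM_apply (𝕜 := ℝ), map_smul, norm_smul, SchwartzMap.toLpCLM_apply,
    norm_toLp_dilate, Real.norm_of_nonneg hr.le]

theorem IsMultiplierWith.ae_norm_mul_le (h : IsMultiplierWith m T) (f : 𝓢(Rd d, ℂ)) :
    ∀ᵐ ξ, ‖ξ‖ * ‖m ξ * 𝓕 f ξ‖ ≤ ‖T‖ * ‖ofSchwartz f‖ := by
  obtain ⟨hm, h⟩ := isMultiplierWith_iff.1 h
  obtain ⟨u, hu, hTu⟩ := h f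
  filter_upwards [ae_all_iff.2 (fourierAt_grad_ae_eq hu)] with ξ hξ
  calc ‖ξ‖ * ‖m ξ * 𝓕 f ξ‖
      ≤ (∑ j : Fin d, ‖derivSymbol (stdVec j) ξ‖) * ‖m ξ * 𝓕 f ξ‖ := by
        gcongr
        exact norm_le_sum_norm_derivSymbol ξ
    _ = ∑ j : Fin d, ‖fourierAt ξ (PreW11.grad j u)‖ := by
        simp only [Finset.sum_mul, ← norm_mul, hξ]
    _ ≤ ∑ j : Fin d, ‖PreW11.grad j u‖ := Finset.sum_le_sum fun j _ => norm_fourierAt_le ξ _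
    _ = ‖T (ofSchwartz f)‖ := by rw [hTu, norm_mk_eq, PreW11.norm_def]
    _ ≤ ‖T‖ * ‖ofSchwartz f‖ := T.le_opNorm _

theorem IsMultiplierWith.ae_norm_le_of_norm_mem_Icc (h : IsMultiplierWith m T) {r : ℝ}
    (hr : 0 < r) :
    ∀ᵐ ξ, ‖ξ‖ ∈ Set.Icc r (2 * r) → ‖m ξ‖ ≤ ‖T‖ * ‖ofSchwartz (lowPass (Rd d))‖ := by
  filter_upwards [h.ae_norm_mul_le (dilate hr (lowPass _))] with ξ hξ hmem
  rw [fourier_dilate_lowPass, cutoff_inv_smul_eq_one hr hmem.2, mul_one, norm_ofSchwartz_dilate,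
    mul_left_comm] at hξ
  refine le_of_mul_le_mul_left ?_ hr
  exact (mul_le_mul_of_nonneg_right hmem.1 (norm_nonneg _)).trans hξ

theorem IsMultiplierWith.ae_norm_le (h : IsMultiplierWith m T) :
    ∀ᵐ ξ, ξ ≠ 0 → ‖m ξ‖ ≤ ‖T‖ * ‖ofSchwartz (lowPass (Rd d))‖ := by
  filter_upwards [ae_all_iff.2 fun n : ℤ =>
    h.ae_norm_le_of_norm_mem_Icc (zpow_pos (two_pos : (0 : ℝ) < 2) n)] with ξ hξ hne
  obtain ⟨n, hle, hlt⟩ := exists_mem_Ico_zpow (norm_pos_iff.2 hne) (one_lt_two : (1 : ℝ) < 2)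
  refine hξ n ⟨hle, hlt.le.trans_eq ?_⟩
  rw [zpow_add_one₀ two_ne_zero, mul_comm]

variable {ms : ℕ → Rd d → ℂ} {Ts : ℕ → (W11 d →L[ℂ] W11 d)} {C : ℝ}

theorem memLp_top_of_tendsto (hT : ∀ k, IsMultiplierWith (ms k) (Ts k)) (hC : ∀ k, ‖Ts k‖ ≤ C)
    (hlim : ∀ᵐ ξ, Tendsto (ms · ξ) atTop (𝓝 (m ξ))) : MemLp m ∞ volume := by
  set M := C * ‖ofSchwartz (lowPass (Rd d))‖
  refine memLp_top_of_bound (C := max M ‖m 0‖)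
    (aestronglyMeasurable_of_tendsto_ae atTop (fun k => (hT k).1.aestronglyMeasurable) hlim) ?_
  filter_upwards [hlim, ae_all_iff.2 fun k => (hT k).ae_norm_le] with ξ hξ hle
  obtain rfl | hne := eq_or_ne ξ 0
  · exact le_max_right _ _
  · refine le_max_of_le_left (le_of_tendsto' hξ.norm fun k => (hle k hne).trans ?_)
    exact mul_le_mul_of_nonneg_right (hC k) (norm_nonneg _)

end MultiplierBound

section Convolution

variable {V : Type*} [NormedAddCommGroup V] [InnerProductSpace ℝ V] [FiniteDimensional ℝ V]
  [MeasurableSpace V] [BorelSpace V]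

/-- The translation `g ↦ g (· - y)` on `L¹`. -/
def translate (y : V) : (V →₁[volume] ℂ) →ₗᵢ[ℂ] (V →₁[volume] ℂ) :=
  Lp.compMeasurePreservingₗᵢ ℂ (fun x => x - y) (measurePreserving_sub_right volume y)

theorem coeFn_translate (y : V) (g : V →₁[volume] ℂ) :
    translate y g =ᵐ[volume] fun x => g (x - y) :=
  Lp.coeFn_compMeasurePreserving g (measurePreserving_sub_right volume y)

theorem continuous_translate (g : V →₁[volume] ℂ) : Continuous fun y => translate y g := by
  let F : C(V, C(V, V)) :=
    (ContinuousMap.mk (fun p : V × V => p.2 - p.1) (by fun_prop)).curry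
  exact Continuous.compMeasurePreservingLp (f := fun _ => g) (g := fun y => F y)
    continuous_const F.continuous (fun y => measurePreserving_sub_right volume y) ENNReal.one_ne_top

theorem translate_zero (g : V →₁[volume] ℂ) : translate 0 g = g := by
  refine Lp.ext ((coeFn_translate 0 g).trans ?_)
  simp

theorem fourierAt_translate (ξ y : V) (g : V →₁[volume] ℂ) :
    fourierAt ξ (translate y g) = Real.fourierChar (-inner ℝ y ξ) • fourierAt ξ g := by
  rw [fourierAt_apply, fourierAt_apply, Real.fourier_congr_ae (coeFn_translate y g)]
  have := congrFun (VectorFourier.fourierIntegral_comp_add_right Real.fourierChar volume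
    (innerₗ V) g (-y)) ξ
  simpa [sub_eq_add_neg] using! this

theorem integrable_smul_translate (a b : V →₁[volume] ℂ) :
    Integrable fun y => a y • translate y b := by
  refine ((L1.integrable_coeFn a).norm.mul_const ‖b‖).mono'
    ((L1.integrable_coeFn a).aestronglyMeasurable.smul
      (continuous_translate b).aestronglyMeasurable) (ae_of_all _ fun y => ?_)
  rw [norm_smul, LinearIsometry.norm_map]

/-- Convolution with an integrable function, as a bounded operator on `L¹`. -/
def conv (a : V →₁[volume] ℂ) : (V →₁[volume] ℂ) →L[ℂ] (V →₁[volume] ℂ) :=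
  LinearMap.mkContinuous
    { toFun b := ∫ y, a y • translate y b
      map_add' b c := by
        simp only [map_add, smul_add]
        exact integral_add (integrable_smul_translate a b) (integrable_smul_translate a c)
      map_smul' t b := by
        simp only [map_smul, RingHom.id_apply]
        rw [← integral_smul]
        congr with y
        rw [smul_comm] }
    ‖a‖ fun b => by
      refine (norm_integral_le_integral_norm _).trans ?_
      simp only [norm_smul, LinearIsometry.norm_map]
      rw [integral_mul_const, L1.norm_eq_integral_norm a]

theorem conv_apply (a b : V →₁[volume] ℂ) : conv a b = ∫ y, a y • translate y b := rfl

theorem fourierAt_conv (ξ : V) (a b : V →₁[volume] ℂ) :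
    fourierAt ξ (conv a b) = fourierAt ξ a * fourierAt ξ b := by
  rw [conv_apply, ← ContinuousLinearMap.integral_comp_comm _ (integrable_smul_translate a b)]
  simp only [map_smul, fourierAt_translate]
  rw [fourierAt_apply ξ a, Real.fourier_eq, ← integral_mul_const]
  congr with y
  simp only [Circle.smul_def, smul_eq_mul]
  ring

theorem conv_comm (a b : V →₁[volume] ℂ) : conv a b = conv b a :=
  ext_fourierAt fun ξ => by rw [fourierAt_conv, fourierAt_conv, mul_comm]

theorem norm_conv_sub_le (a b : V →₁[volume] ℂ) :
    ‖conv a b - fourierAt 0 a • b‖ ≤ ∫ y, ‖a y‖ * ‖translate y b - b‖ := by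
  have h : conv a b - fourierAt 0 a • b = ∫ y, a y • (translate y b - b) := by
    simp only [smul_sub]
    rw [integral_sub (integrable_smul_translate a b) ((L1.integrable_coeFn a).smul_const b),
      integral_smul_const, conv_apply, fourierAt_apply, fourier_zero]
  rw [h]
  refine (norm_integral_le_integral_norm _).trans (le_of_eq ?_)
  simp only [norm_smul]

theorem norm_translate_sub_le (y : V) (b : V →₁[volume] ℂ) :
    ‖translate y b - b‖ ≤ 2 * ‖b‖ := by
  refine (norm_sub_le _ _).trans ?_
  rw [LinearIsometry.norm_map, two_mul]

theorem continuous_norm_translate_sub (b : V →₁[volume] ℂ) :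
    Continuous fun y => ‖translate y b - b‖ :=
  ((continuous_translate b).sub continuous_const).norm

theorem tendsto_integral_mul_norm_translate_sub {a : V → ℂ} (ha : Integrable a)
    (b : V →₁[volume] ℂ) {ι : Type*} {l : Filter ι} [l.IsCountablyGenerated] {s : ι → ℝ}
    (hs : Tendsto s l (𝓝 0)) :
    Tendsto (fun i => ∫ y, ‖a y‖ * ‖translate (s i • y) b - b‖) l (𝓝 0) := by
  have h := tendsto_integral_filter_of_dominated_convergence (μ := volume) (l := l)
    (F := fun i y => ‖a y‖ * ‖translate (s i • y) b - b‖) (f := fun _ => (0 : ℝ))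
    (fun y => ‖a y‖ * (2 * ‖b‖)) ?_ ?_ (ha.norm.mul_const _) ?_
  · simpa using h
  · refine Eventually.of_forall fun i => ha.norm.aestronglyMeasurable.mul ?_
    exact ((continuous_norm_translate_sub b).comp
      (continuous_const_smul (s i))).aestronglyMeasurable
  · refine Eventually.of_forall fun i => ae_of_all _ fun y => ?_
    rw [Real.norm_of_nonneg (by positivity)]
    gcongr
    exact norm_translate_sub_le _ b
  · refine ae_of_all _ fun y => ?_
    have hsmul : Tendsto (fun i => s i • y) l (𝓝 0) := by simpa using hs.smul_const y
    have hnorm := ((continuous_norm_translate_sub b).tendsto 0).comp hsmul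
    rw [translate_zero, sub_self, norm_zero] at hnorm
    simpa using hnorm.const_mul ‖a y‖

theorem norm_translate_toLp_sub (y : V) (f : 𝓢(V, ℂ)) :
    ‖translate y (f.toLp 1 volume) - f.toLp 1 volume‖ = ∫ x, ‖f (x - y) - f x‖ := by
  rw [L1.norm_eq_integral_norm]
  refine integral_congr_ae ?_
  have hf := f.coeFn_toLp 1 volume
  filter_upwards [Lp.coeFn_sub (translate y (f.toLp 1 volume)) (f.toLp 1 volume),
    coeFn_translate y (f.toLp 1 volume), hf,
    (measurePreserving_sub_right volume y).quasiMeasurePreserving.ae_eq_comp hf]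
    with x hsub htranslate hfx hfy
  rw [hsub, Pi.sub_apply, htranslate, hfx]
  exact congrArg (‖· - f x‖) hfy

theorem norm_translate_toLp_dilate_sub {r : ℝ} (hr : 0 < r) (f : 𝓢(V, ℂ)) (y : V) :
    ‖translate y ((dilate hr f).toLp 1 volume) - (dilate hr f).toLp 1 volume‖ =
      ‖translate (r • y) (f.toLp 1 volume) - f.toLp 1 volume‖ := by
  rw [norm_translate_toLp_sub, norm_translate_toLp_sub,
    ← integral_pow_finrank_smul_comp_smul hr fun x => ‖f (x - r • y) - f x‖]
  congr with x
  rw [dilate_apply, dilate_apply, ← mul_sub, norm_mul, norm_pow, Complex.norm_of_nonneg hr.le,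
    smul_sub, smul_eq_mul]

variable {r : ℕ → ℝ} (hr : ∀ n, 0 < r n)

theorem tendsto_conv_dilate_lowPass_atTop (hlim : Tendsto r atTop atTop) (g : V →₁[volume] ℂ) :
    Tendsto (fun n => conv ((dilate (hr n) (lowPass V)).toLp 1) g) atTop (𝓝 g) := by
  rw [tendsto_iff_norm_sub_tendsto_zero]
  refine squeeze_zero (fun n => norm_nonneg _) (fun n => ?_)
    (tendsto_integral_mul_norm_translate_sub (lowPass V).integrable g
      (tendsto_inv_atTop_zero.comp hlim))
  have h := norm_conv_sub_le ((dilate (hr n) (lowPass V)).toLp 1) g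
  rw [fourierAt_toLp, fourier_dilate_lowPass, smul_zero, cutoff_eq_one (by simp), one_smul] at h
  refine h.trans_eq ?_
  rw [← integral_pow_finrank_smul_comp_smul (hr n) fun y => ‖lowPass V y‖ * _]
  refine integral_congr_ae ?_
  filter_upwards [(dilate (hr n) (lowPass V)).coeFn_toLp 1 volume] with x hx
  rw [hx, norm_dilate_apply, Function.comp_apply, inv_smul_smul₀ (hr n).ne', smul_eq_mul, mul_assoc]

theorem tendsto_conv_dilate_lowPass_zero (hlim : Tendsto r atTop (𝓝 0)) {g : V →₁[volume] ℂ}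
    (hg : fourierAt 0 g = 0) :
    Tendsto (fun n => conv ((dilate (hr n) (lowPass V)).toLp 1) g) atTop (𝓝 0) := by
  rw [tendsto_zero_iff_norm_tendsto_zero]
  refine squeeze_zero (fun n => norm_nonneg _) (fun n => ?_)
    (tendsto_integral_mul_norm_translate_sub (L1.integrable_coeFn g) ((lowPass V).toLp 1) hlim)
  have h := norm_conv_sub_le g ((dilate (hr n) (lowPass V)).toLp 1)
  rw [hg, zero_smul, sub_zero, conv_comm] at h
  simpa only [norm_translate_toLp_dilate_sub] using h

end Convolution

section CurlFree

variable {d : ℕ}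

theorem integral_lineDerivOp_mul_grad_comm (u : PreW11 d) (i j : Fin d)
    (φ : 𝓓((⊤ : Opens (Rd d)), ℝ)) :
    ∫ x, (∂_{stdVec i} (testToSchwartz φ) : 𝓢(Rd d, ℂ)) x * PreW11.grad j u x =
      ∫ x, (∂_{stdVec j} (testToSchwartz φ) : 𝓢(Rd d, ℂ)) x * PreW11.grad i u x := by
  have hsecond (i j : Fin d) :
      ∫ x, (∂_{stdVec i} (testToSchwartz φ) : 𝓢(Rd d, ℂ)) x * PreW11.grad j u x =
        -PreW11.toDistr d u (∂_{stdVec j} (∂_{stdVec i} φ)) := by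
    rw [← pderiv_apply, ← PreW11.ofL1_grad, ← testToSchwartz_lineDerivOp]
    exact (ofFun_apply_eq_integral_mul (L1_locallyIntegrable _) _).symm
  have hcomm : ∂_{stdVec j} (∂_{stdVec i} φ) = ∂_{stdVec i} (∂_{stdVec j} φ) := by
    apply testToSchwartz_injective
    simp only [testToSchwartz_lineDerivOp]
    exact lineDerivOp_comm _ _ _
  rw [hsecond, hsecond, hcomm]

open scoped Convolution in
theorem grad_convolution_lineDerivOp_comm (u : PreW11 d) (i j : Fin d)
    (φ : 𝓓((⊤ : Opens (Rd d)), ℝ)) :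
    ((PreW11.grad j u : Rd d → ℂ) ⋆[ContinuousLinearMap.mul ℂ ℂ]
        (∂_{stdVec i} (testToSchwartz φ) : 𝓢(Rd d, ℂ))) =
      ((PreW11.grad i u : Rd d → ℂ) ⋆[ContinuousLinearMap.mul ℂ ℂ]
        (∂_{stdVec j} (testToSchwartz φ) : 𝓢(Rd d, ℂ))) := by
  ext x
  let ψ : 𝓓((⊤ : Opens (Rd d)), ℝ) :=
    ⟨fun y => φ (x - y), φ.contDiff.comp (contDiff_const.sub contDiff_id),
      φ.hasCompactSupport.comp_homeomorph (Homeomorph.subLeft x), fun _ _ => trivial⟩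
  have hψ (v y : Rd d) : (∂_{v} (testToSchwartz ψ) : 𝓢(Rd d, ℂ)) y =
      -(∂_{v} (testToSchwartz φ) : 𝓢(Rd d, ℂ)) (x - y) := by
    rw [SchwartzMap.lineDerivOp_apply_eq_fderiv, SchwartzMap.lineDerivOp_apply_eq_fderiv]
    have : (testToSchwartz ψ : Rd d → ℂ) = fun y => testToSchwartz φ (x - y) := rfl
    have hderiv : HasFDerivAt (fun y => testToSchwartz φ (x - y))
        ((fderiv ℝ (testToSchwartz φ) (x - y)).comp (-ContinuousLinearMap.id ℝ (Rd d))) y :=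
      ((testToSchwartz φ).differentiableAt.hasFDerivAt).comp y
        ((hasFDerivAt_id y).const_sub x)
    rw [this, hderiv.fderiv]
    simp
  have h := integral_lineDerivOp_mul_grad_comm u i j ψ
  simp only [hψ, neg_mul, integral_neg, neg_inj] at h
  simpa [convolution_def, mul_comm] using h

theorem exists_testFunction_fourier_ne_zero (ξ : Rd d) :
    ∃ φ : 𝓓((⊤ : Opens (Rd d)), ℝ), 𝓕 (testToSchwartz φ) ξ ≠ 0 := by
  let b : ContDiffBump (0 : Rd d) := ⟨1, 2, by norm_num, by norm_num⟩
  let β : 𝓓((⊤ : Opens (Rd d)), ℝ) := ⟨b, b.contDiff, b.hasCompactSupport, fun _ _ => trivial⟩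
  have hzero : 𝓕 (testToSchwartz β) 0 ≠ 0 := by
    rw [SchwartzMap.fourier_coe, fourier_zero]
    change ∫ x, (b x : ℂ) ≠ 0
    rw [integral_complex_ofReal]
    exact_mod_cast b.integral_pos.ne'
  have hlim : Tendsto (fun r : ℝ => 𝓕 (testToSchwartz β) (r⁻¹ • ξ)) atTop
      (𝓝 (𝓕 (testToSchwartz β) 0)) := by
    refine ((𝓕 (testToSchwartz β)).continuous.tendsto 0).comp ?_
    simpa using (tendsto_inv_atTop_zero (𝕜 := ℝ)).smul_const ξ
  obtain ⟨r, hne, hr⟩ := ((hlim.eventually_ne hzero).and (eventually_gt_atTop 0)).exists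
  let φ : 𝓓((⊤ : Opens (Rd d)), ℝ) := ⟨fun x => r ^ Module.finrank ℝ (Rd d) * b (r • x),
    contDiff_const.mul (b.contDiff.comp (contDiff_const_smul r)),
    (b.hasCompactSupport.comp_smul hr.ne').mul_left, fun _ _ => trivial⟩
  have hφ : testToSchwartz φ = dilate hr (testToSchwartz β) := by
    ext x
    rw [testToSchwartz_apply, dilate_apply, testToSchwartz_apply]
    change ((r ^ Module.finrank ℝ (Rd d) * b (r • x) : ℝ) : ℂ) =
      (r : ℂ) ^ Module.finrank ℝ (Rd d) * ((b (r • x) : ℝ) : ℂ)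
    push_cast
    rfl
  exact ⟨φ, by rwa [hφ, fourier_dilate]⟩

/- Convolving with `∂_i φ` avoids differentiating an `L¹` function; the factor `𝓕 φ ξ` is cancelled
in the end. -/
theorem derivSymbol_mul_fourierAt_grad_comm (u : PreW11 d) (i j : Fin d) (ξ : Rd d) :
    derivSymbol (stdVec i) ξ * fourierAt ξ (PreW11.grad j u) =
      derivSymbol (stdVec j) ξ * fourierAt ξ (PreW11.grad i u) := by
  obtain ⟨φ, hφ⟩ := exists_testFunction_fourier_ne_zero ξ
  have h := congrArg (fun g : Rd d → ℂ => 𝓕 g ξ) (grad_convolution_lineDerivOp_comm u i j φ)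
  rw [Real.fourier_mul_convolution_eq (L1.integrable_coeFn _) (SchwartzMap.integrable _),
    Real.fourier_mul_convolution_eq (L1.integrable_coeFn _) (SchwartzMap.integrable _),
    ← SchwartzMap.fourier_coe, ← SchwartzMap.fourier_coe, fourier_lineDerivOp_apply,
    fourier_lineDerivOp_apply] at h
  rw [fourierAt_apply, fourierAt_apply]
  refine mul_right_cancel₀ hφ ?_
  linear_combination h

/-- The Fourier transform at `ξ` of the `j`-th component of an `L¹` vector field. -/
def componentFourierAt (ξ : Rd d) (j : Fin d) :
    (PiLp 1 fun _ : Fin d => Rd d →₁[volume] ℂ) →L[ℂ] ℂ :=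
  (fourierAt ξ).comp (PiLp.proj (𝕜 := ℂ) 1 (fun _ : Fin d => Rd d →₁[volume] ℂ) j)

/-- The curl-free `L¹` vector fields: the condition `∂_i h_j = ∂_j h_i` is expressed through the
Fourier transforms, which are continuous functions. -/
def curlFree (d : ℕ) : Submodule ℂ (PiLp 1 fun _ : Fin d => Rd d →₁[volume] ℂ) :=
  ⨅ (i : Fin d) (j : Fin d) (ξ : Rd d), LinearMap.ker
    (derivSymbol (stdVec i) ξ • componentFourierAt ξ j -
      derivSymbol (stdVec j) ξ • componentFourierAt ξ i).toLinearMap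

theorem mem_curlFree {h : PiLp 1 fun _ : Fin d => Rd d →₁[volume] ℂ} :
    h ∈ curlFree d ↔ ∀ i j ξ, derivSymbol (stdVec i) ξ * fourierAt ξ (h j) =
      derivSymbol (stdVec j) ξ * fourierAt ξ (h i) := by
  simp [curlFree, componentFourierAt, Submodule.mem_iInf, sub_eq_zero]

theorem isClosed_curlFree (d : ℕ) :
    IsClosed (curlFree d : Set (PiLp 1 fun _ : Fin d => Rd d →₁[volume] ℂ)) := by
  simp only [curlFree, Submodule.coe_iInf]
  exact isClosed_iInter fun i => isClosed_iInter fun j => isClosed_iInter fun ξ =>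
    ContinuousLinearMap.isClosed_ker _

instance (d : ℕ) : CompleteSpace (curlFree d) := (isClosed_curlFree d).completeSpace_coe

theorem gradient_mem_curlFree (q : W11 d) : gradient d q ∈ curlFree d := by
  obtain ⟨u, rfl⟩ := Submodule.Quotient.mk_surjective _ q
  exact mem_curlFree.2 fun i j ξ => derivSymbol_mul_fourierAt_grad_comm u i j ξ

end CurlFree

section Density

theorem exists_schwartz_mul_eq {V : Type*} [NormedAddCommGroup V] [NormedSpace ℝ V]
    {w p : V → ℂ} (hw : ContDiff ℝ ∞ w) (hp : ContDiff ℝ ∞ p) (hpc : HasCompactSupport p)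
    (hne : ∀ ξ ∈ tsupport p, w ξ ≠ 0) : ∃ q : 𝓢(V, ℂ), ∀ ξ, w ξ * q ξ = p ξ := by
  have hsmooth : ContDiff ℝ ∞ fun ξ => p ξ * (w ξ)⁻¹ := contDiff_iff_contDiffAt.2 fun ξ => by
    by_cases hξ : ξ ∈ tsupport p
    · exact hp.contDiffAt.mul (hw.contDiffAt.inv (hne ξ hξ))
    · refine contDiffAt_const (c := (0 : ℂ)) |>.congr_of_eventuallyEq ?_
      filter_upwards [notMem_tsupport_iff_eventuallyEq.1 hξ] with η hη
      rw [hη, Pi.zero_apply, zero_mul]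
  refine ⟨HasCompactSupport.toSchwartzMap (f := fun ξ => p ξ * (w ξ)⁻¹) ?_ hsmooth, fun ξ => ?_⟩
  · exact hpc.mul_right
  · change w ξ * (p ξ * (w ξ)⁻¹) = p ξ
    by_cases hξ : ξ ∈ tsupport p
    · field_simp [hne ξ hξ]
    · rw [image_eq_zero_of_notMem_tsupport hξ, zero_mul, mul_zero]

variable {d : ℕ}

theorem sum_derivSymbol_sq (ξ : Rd d) :
    ∑ i : Fin d, derivSymbol (stdVec i) ξ ^ 2 = ((-(2 * Real.pi) ^ 2 * ‖ξ‖ ^ 2 : ℝ) : ℂ) := by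
  have hterm (i : Fin d) :
      derivSymbol (stdVec i) ξ ^ 2 = ((-(2 * Real.pi) ^ 2 * ‖ξ i‖ ^ 2 : ℝ) : ℂ) := by
    rw [derivSymbol, EuclideanSpace.inner_single_right, Real.norm_eq_abs, sq_abs]
    simp [mul_pow]
  simp only [hterm]
  rw [← Complex.ofReal_sum, ← Finset.mul_sum, EuclideanSpace.norm_sq_eq]

theorem sum_derivSymbol_sq_ne_zero {ξ : Rd d} (hξ : ξ ≠ 0) :
    ∑ i : Fin d, derivSymbol (stdVec i) ξ ^ 2 ≠ 0 := by
  rw [sum_derivSymbol_sq]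
  have := norm_pos_iff.2 hξ
  exact_mod_cast mul_ne_zero (neg_ne_zero.2 (by positivity)) (by positivity)

theorem exists_laplacian_eq {ρ R : ℝ} (hρ : 0 < ρ) (hR : 0 < R) (hρR : ρ ≤ R) :
    ∃ Q : 𝓢(Rd d, ℂ), ∀ ξ, (∑ i : Fin d, derivSymbol (stdVec i) ξ ^ 2) * 𝓕 Q ξ =
      𝓕 (dilate hR (lowPass (Rd d))) ξ - 𝓕 (dilate hρ (lowPass (Rd d))) ξ := by
  set p : 𝓢(Rd d, ℂ) := 𝓕 (dilate hR (lowPass (Rd d))) - 𝓕 (dilate hρ (lowPass (Rd d))) with hp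
  have hp_low {ξ : Rd d} (hξ : ‖ξ‖ ≤ 2 * ρ) : p ξ = 0 := by
    rw [hp, sub_apply, fourier_dilate_lowPass, fourier_dilate_lowPass, cutoff_inv_smul_eq_one hρ hξ,
      cutoff_inv_smul_eq_one hR (hξ.trans (by gcongr)), sub_self]
  have hp_high {ξ : Rd d} (hξ : 3 * R ≤ ‖ξ‖) : p ξ = 0 := by
    rw [hp, sub_apply, fourier_dilate_lowPass, fourier_dilate_lowPass,
      cutoff_inv_smul_eq_zero hR hξ, cutoff_inv_smul_eq_zero hρ (hξ.trans' (by gcongr)), sub_self]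
  have hsupport : HasCompactSupport p :=
    HasCompactSupport.intro (isCompact_closedBall 0 (3 * R)) fun ξ hξ => hp_high <| by
      rw [mem_closedBall_zero_iff, not_le] at hξ
      exact hξ.le
  have hne : ∀ ξ ∈ tsupport p, ξ ≠ 0 := by
    rintro _ hξ rfl
    refine notMem_tsupport_iff_eventuallyEq.2 ?_ hξ
    filter_upwards [Metric.ball_mem_nhds (0 : Rd d) (show 0 < 2 * ρ by positivity)] with η hη
    exact hp_low (mem_ball_zero_iff.1 hη).le
  have hsymbol : ContDiff ℝ ∞ fun ξ : Rd d => ∑ i : Fin d, derivSymbol (stdVec i) ξ ^ 2 := by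
    simp only [sum_derivSymbol_sq]
    exact Complex.ofRealCLM.contDiff.comp (contDiff_const.mul (contDiff_norm_sq ℝ))
  obtain ⟨q, hq⟩ := exists_schwartz_mul_eq hsymbol (p.smooth ⊤) hsupport fun ξ hξ =>
    sum_derivSymbol_sq_ne_zero (hne ξ hξ)
  exact ⟨𝓕⁻ q, fun ξ => by rw [FourierTransform.fourier_fourierInv_eq, hq ξ, hp, sub_apply]⟩

/-- The vector field `∇ ∑ i, (∂_i Q * h_i)`, a smoothed version of `∇ Δ⁻¹ div h`. -/
def hessConv (Q : 𝓢(Rd d, ℂ)) (h : PiLp 1 fun _ : Fin d => Rd d →₁[volume] ℂ) :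
    PiLp 1 fun _ : Fin d => Rd d →₁[volume] ℂ :=
  WithLp.toLp 1 fun j => ∑ i, conv ((∂_{stdVec j} (∂_{stdVec i} Q) : 𝓢(Rd d, ℂ)).toLp 1) (h i)

theorem continuous_hessConv (Q : 𝓢(Rd d, ℂ)) : Continuous (hessConv Q) :=
  (PiLp.continuous_toLp 1 _).comp <| continuous_pi fun _ => continuous_finsetSum _ fun i _ =>
    (conv _).continuous.comp (PiLp.continuous_apply 1 _ i)

theorem hessConv_toLp_eq_gradient (Q : 𝓢(Rd d, ℂ)) (s : Fin d → 𝓢(Rd d, ℂ)) :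
    hessConv Q (WithLp.toLp 1 fun i => (s i).toLp 1) = gradient d (ofSchwartz
      (∑ i, SchwartzMap.convolution (ContinuousLinearMap.mul ℂ ℂ) (∂_{stdVec i} Q) (s i))) := by
  refine PiLp.ext fun j => ext_fourierAt fun ξ => ?_
  rw [gradient_ofSchwartz, fourierAt_toLp, fourier_lineDerivOp_apply, FourierTransform.fourier_sum]
  simp only [hessConv, map_sum, sum_apply, fourierAt_conv, fourierAt_toLp,
    fourier_lineDerivOp_apply, SchwartzMap.fourier_convolution, SchwartzMap.pairing_apply_apply,
    ContinuousLinearMap.mul_apply', Finset.mul_sum, mul_assoc]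

theorem hessConv_mem_closure (Q : 𝓢(Rd d, ℂ)) (h : PiLp 1 fun _ : Fin d => Rd d →₁[volume] ℂ) :
    hessConv Q h ∈ closure (Set.range fun f => gradient d (ofSchwartz f)) := by
  have hdense : DenseRange fun s : Fin d → 𝓢(Rd d, ℂ) =>
      (WithLp.toLp 1 fun i => (s i).toLp 1 volume : PiLp 1 fun _ => Rd d →₁[volume] ℂ) :=
    (WithLp.toLp_surjective 1).denseRange.comp
      (DenseRange.piMap fun _ => SchwartzMap.denseRange_toLpCLM ENNReal.one_ne_top)
      (PiLp.continuous_toLp 1 _)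
  refine closure_mono ?_
    (image_closure_subset_closure_image (continuous_hessConv Q) ⟨h, hdense h, rfl⟩)
  rintro _ ⟨_, ⟨s, rfl⟩, rfl⟩
  exact ⟨_, (hessConv_toLp_eq_gradient Q s).symm⟩

theorem hessConv_of_mem_curlFree {h : PiLp 1 fun _ : Fin d => Rd d →₁[volume] ℂ}
    (hh : h ∈ curlFree d) {Q k₁ k₂ : 𝓢(Rd d, ℂ)}
    (hQ : ∀ ξ, (∑ i : Fin d, derivSymbol (stdVec i) ξ ^ 2) * 𝓕 Q ξ = 𝓕 k₁ ξ - 𝓕 k₂ ξ)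
    (j : Fin d) : hessConv Q h j = conv (k₁.toLp 1) (h j) - conv (k₂.toLp 1) (h j) := by
  refine ext_fourierAt fun ξ => ?_
  simp only [hessConv, map_sum, map_sub, fourierAt_conv, fourierAt_toLp, fourier_lineDerivOp_apply]
  rw [← sub_mul, ← hQ, Finset.sum_mul, Finset.sum_mul]
  refine Finset.sum_congr rfl fun i _ => ?_
  linear_combination (-derivSymbol (stdVec i) ξ * 𝓕 Q ξ) * mem_curlFree.1 hh i j ξ

theorem mem_closure_range_gradient_ofSchwartz
    {h : PiLp 1 fun _ : Fin d => Rd d →₁[volume] ℂ} (hh : h ∈ curlFree d)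
    (hmean : ∀ j, fourierAt 0 (h j) = 0) :
    h ∈ closure (Set.range fun f => gradient d (ofSchwartz f)) := by
  have hR (n : ℕ) : (0 : ℝ) < n + 1 := by positivity
  have hρ (n : ℕ) : (0 : ℝ) < 1 / (n + 1) := by positivity
  have hρR (n : ℕ) : 1 / ((n : ℝ) + 1) ≤ n + 1 := by
    rw [div_le_iff₀ (hR n)]
    nlinarith [n.cast_nonneg (α := ℝ)]
  choose Q hQ using fun n => exists_laplacian_eq (d := d) (hρ n) (hR n) (hρR n)
  refine isClosed_closure.mem_of_tendsto (f := fun n => hessConv (Q n) h) (b := atTop) ?_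
    (Eventually.of_forall fun n => hessConv_mem_closure (Q n) h)
  refine (PiLp.homeomorph 1 _).isInducing.tendsto_nhds_iff.2 (tendsto_pi_nhds.2 fun j => ?_)
  have hhigh := tendsto_conv_dilate_lowPass_atTop hR
    (tendsto_atTop_add_const_right _ 1 tendsto_natCast_atTop_atTop) (h j)
  have hlow := tendsto_conv_dilate_lowPass_zero hρ tendsto_one_div_add_atTop_nhds_zero_nat (hmean j)
  have := hhigh.sub hlow
  rw [sub_zero] at this
  exact this.congr fun n => (hessConv_of_mem_curlFree hh (hQ n) j).symm

end Density

section TemperedSingularity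

section Pointwise

variable {V : Type*} [NormedAddCommGroup V] [NormedSpace ℝ V]

theorem norm_sub_le_seminorm_mul_norm (η : 𝓢(V, ℂ)) (ξ : V) :
    ‖η ξ - η 0‖ ≤ SchwartzMap.seminorm ℂ 0 1 η * ‖ξ‖ := by
  have hderiv : ∀ x ∈ Set.univ, ‖fderiv ℝ η x‖ ≤ SchwartzMap.seminorm ℂ 0 1 η := by
    intro x _
    have := SchwartzMap.le_seminorm ℂ 0 1 η x
    rwa [pow_zero, one_mul, norm_iteratedFDeriv_one] at this
  simpa using convex_univ.norm_image_sub_le_of_norm_fderiv_le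
    (fun x _ => η.differentiableAt) hderiv (Set.mem_univ 0) (Set.mem_univ ξ)

/- As `C / 0 = 0`, the hypothesis `hp` includes `p 0 = 0`. -/
theorem norm_sub_mul_le {p : V → ℂ} {C : ℝ} (hC : 0 ≤ C) (hp : ∀ ξ, ‖p ξ‖ ≤ C / ‖ξ‖)
    (η : 𝓢(V, ℂ)) (ξ : V) : ‖(η ξ - η 0) * p ξ‖ ≤ C * SchwartzMap.seminorm ℂ 0 1 η := by
  have : 0 ≤ SchwartzMap.seminorm ℂ 0 1 η := apply_nonneg _ _
  calc ‖(η ξ - η 0) * p ξ‖ ≤ (SchwartzMap.seminorm ℂ 0 1 η * ‖ξ‖) * (C / ‖ξ‖) := by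
        rw [norm_mul]
        gcongr
        · exact norm_sub_le_seminorm_mul_norm η ξ
        · exact hp ξ
    _ = C * SchwartzMap.seminorm ℂ 0 1 η * (‖ξ‖ / ‖ξ‖) := by ring
    _ ≤ C * SchwartzMap.seminorm ℂ 0 1 η :=
        mul_le_of_le_one_right (by positivity) (div_self_le_one _)

end Pointwise

variable {V : Type*} [NormedAddCommGroup V] [InnerProductSpace ℝ V] [FiniteDimensional ℝ V]
  [MeasurableSpace V] [BorelSpace V] {p : V → ℂ} {C : ℝ}

theorem integrableOn_ball_sub_mul (hC : 0 ≤ C) (hp : ∀ ξ, ‖p ξ‖ ≤ C / ‖ξ‖)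
    (hmeas : AEStronglyMeasurable p volume) (η : 𝓢(V, ℂ)) :
    IntegrableOn (fun ξ => (η ξ - η 0) * p ξ) (Metric.ball 0 1) :=
  Measure.integrableOn_of_bounded measure_ball_lt_top.ne
    ((η.continuous.sub continuous_const).aestronglyMeasurable.mul hmeas)
    (ae_of_all _ (norm_sub_mul_le hC hp η))

/-- The tempered distribution `η ↦ ∫_B (η - η(0)) p` on the unit ball `B`. Subtracting `η(0)`
regularizes a singularity of `p` at the origin that need not be integrable. -/
def regularizedBallIntegral (hC : 0 ≤ C) (hp : ∀ ξ, ‖p ξ‖ ≤ C / ‖ξ‖)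
    (hmeas : AEStronglyMeasurable p volume) : 𝓢(V, ℂ) →L[ℂ] ℂ :=
  SchwartzMap.mkCLMtoNormedSpace (fun η => ∫ ξ in Metric.ball 0 1, (η ξ - η 0) * p ξ)
    (fun η θ => by
      rw [← integral_add (integrableOn_ball_sub_mul hC hp hmeas η)
        (integrableOn_ball_sub_mul hC hp hmeas θ)]
      congr with ξ
      simp only [add_apply]
      ring)
    (fun a η => by
      rw [RingHom.id_apply, ← integral_smul]
      congr with ξ
      simp only [smul_apply, smul_eq_mul]
      ring)
    ⟨{(0, 1)}, C * volume.real (Metric.ball (0 : V) 1), by positivity, fun η => by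
      rw [Finset.sup_singleton, mul_right_comm]
      exact norm_setIntegral_le_of_norm_le_const measure_ball_lt_top
        fun ξ _ => norm_sub_mul_le hC hp η ξ⟩

theorem memLp_top_indicator_compl_ball (hC : 0 ≤ C) (hp : ∀ ξ, ‖p ξ‖ ≤ C / ‖ξ‖)
    (hmeas : AEStronglyMeasurable p volume) :
    MemLp ((Metric.ball (0 : V) 1)ᶜ.indicator p) ∞ volume := by
  refine memLp_top_of_bound (hmeas.indicator Metric.isOpen_ball.measurableSet.compl) C
    (ae_of_all _ fun ξ => ?_)
  by_cases hξ : ξ ∈ (Metric.ball (0 : V) 1)ᶜ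
  · rw [Set.indicator_of_mem hξ]
    rw [Set.mem_compl_iff, mem_ball_zero_iff, not_lt] at hξ
    exact (hp ξ).trans (div_le_self hC hξ)
  · rwa [Set.indicator_of_notMem hξ, norm_zero]

theorem exists_temperedDistribution_eq_integral_of_norm_le_div (hC : 0 ≤ C)
    (hp : ∀ ξ, ‖p ξ‖ ≤ C / ‖ξ‖) (hmeas : AEStronglyMeasurable p volume) :
    ∃ v : 𝓢'(V, ℂ), ∀ η : 𝓢(V, ℂ), η 0 = 0 → v η = ∫ ξ, η ξ * p ξ := by
  have hbdd := memLp_top_indicator_compl_ball hC hp hmeas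
  refine ⟨ContinuousLinearMap.toPointwiseConvergenceCLM ℂ (RingHom.id ℂ) _ _
    (regularizedBallIntegral hC hp hmeas) + Lp.toTemperedDistribution (hbdd.toLp _),
    fun η hη => ?_⟩
  have hball : regularizedBallIntegral hC hp hmeas η =
      ∫ ξ, (Metric.ball (0 : V) 1).indicator (fun ξ => η ξ * p ξ) ξ := by
    rw [integral_indicator Metric.isOpen_ball.measurableSet]
    change ∫ ξ in Metric.ball 0 1, (η ξ - η 0) * p ξ = _
    simp only [hη, sub_zero]
  have hcompl : Lp.toTemperedDistribution (hbdd.toLp _) η =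
      ∫ ξ, η ξ * (Metric.ball (0 : V) 1)ᶜ.indicator p ξ := by
    rw [Lp.toTemperedDistribution_apply]
    refine integral_congr_ae ?_
    filter_upwards [hbdd.coeFn_toLp] with ξ hξ
    rw [hξ, smul_eq_mul]
  have hint : IntegrableOn (fun ξ => η ξ * p ξ) (Metric.ball 0 1) := by
    simpa only [hη, sub_zero] using integrableOn_ball_sub_mul hC hp hmeas η
  change regularizedBallIntegral hC hp hmeas η + Lp.toTemperedDistribution (hbdd.toLp _) η = _
  rw [hball, hcompl, ← integral_add (hint.integrable_indicator Metric.isOpen_ball.measurableSet)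
    (by simpa only [mul_comm] using integrable_mul_schwartz hbdd η)]
  congr with ξ
  by_cases hξ : ξ ∈ Metric.ball (0 : V) 1 <;> simp [hξ]

end TemperedSingularity

section Restriction

variable {d : ℕ}

theorem testToSchwartz_add (φ ψ : 𝓓((⊤ : Opens (Rd d)), ℝ)) :
    testToSchwartz (φ + ψ) = testToSchwartz φ + testToSchwartz ψ := by
  ext x
  simp [testToSchwartz_apply]

theorem testToSchwartz_smul (c : ℝ) (φ : 𝓓((⊤ : Opens (Rd d)), ℝ)) :
    testToSchwartz (c • φ) = c • testToSchwartz φ := by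
  ext x
  simp [testToSchwartz_apply]

theorem seminorm_testToSchwartz_le {K : Compacts (Rd d)} {R : ℝ}
    (hK : ∀ x ∈ K, ‖x‖ ≤ R) (hR : 0 ≤ R) (k n : ℕ) (φ : 𝓓_{K}(Rd d, ℝ)) :
    SchwartzMap.seminorm ℝ k n
        (testToSchwartz (TestFunction.ofSupportedIn (Ω := ⊤) (fun _ _ => trivial) φ)) ≤
      R ^ k * ContDiffMapSupportedIn.seminorm ℝ (Rd d) ℝ ⊤ K n φ := by
  refine SchwartzMap.seminorm_le_bound ℝ k n _
    (mul_nonneg (pow_nonneg hR k) (apply_nonneg _ _)) fun x => ?_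
  have hcoe : (testToSchwartz (TestFunction.ofSupportedIn (Ω := ⊤) (fun _ _ => trivial) φ) :
      Rd d → ℂ) = Complex.ofRealLI ∘ φ := rfl
  rw [hcoe, LinearIsometry.norm_iteratedFDeriv_comp_left Complex.ofRealLI φ.contDiff.contDiffAt
    (mod_cast le_top)]
  by_cases hx : x ∈ K
  · gcongr
    · exact hK x hx
    · exact ContDiffMapSupportedIn.norm_iteratedFDeriv_apply_le_seminorm_top ℝ
  · have hzero : iteratedFDeriv ℝ n φ x = 0 := φ.iteratedFDeriv_zero_on_compl hx
    rw [hzero, norm_zero, mul_zero]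
    exact mul_nonneg (pow_nonneg hR k) (apply_nonneg _ _)

/-- The continuous inclusion of the real test functions into the Schwartz functions. -/
def testToSchwartzCLM (d : ℕ) : 𝓓((⊤ : Opens (Rd d)), ℝ) →L[ℝ] 𝓢(Rd d, ℂ) :=
  TestFunction.mkCLM ℝ testToSchwartz testToSchwartz_add testToSchwartz_smul fun K hK => by
    obtain ⟨R, hR⟩ := K.isCompact.isBounded.exists_norm_le
    let ι : 𝓓_{K}(Rd d, ℝ) →ₗ[ℝ] 𝓢(Rd d, ℂ) :=
      { toFun φ := testToSchwartz (TestFunction.ofSupportedIn hK φ)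
        map_add' φ ψ := by
          exact testToSchwartz_add (TestFunction.ofSupportedIn hK φ)
            (TestFunction.ofSupportedIn hK ψ)
        map_smul' c φ := by
          exact testToSchwartz_smul c (TestFunction.ofSupportedIn hK φ) }
    refine WithSeminorms.continuous_of_isBounded
      (ContDiffMapSupportedIn.withSeminorms ℝ (Rd d) ℝ ⊤ K)
      (schwartz_withSeminorms ℝ (Rd d) ℂ) ι fun p =>
        ⟨{p.2}, (⟨(max R 0) ^ p.1, by positivity⟩ : NNReal), fun φ => ?_⟩
    rw [Finset.sup_singleton]
    exact seminorm_testToSchwartz_le (fun x hx => (hR x hx).trans (le_max_left _ _))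
      (le_max_right _ _) p.1 p.2 φ

theorem exists_isRestriction (v : 𝓢'(Rd d, ℂ)) : ∃ u : Distr d, IsRestriction u v :=
  ⟨((v : 𝓢(Rd d, ℂ) →L[ℂ] ℂ).restrictScalars ℝ).comp (testToSchwartzCLM d), fun _ => rfl⟩

end Restriction

section Potential

variable {d : ℕ}

/-- The Fourier transform, away from the origin, of a potential `Δ⁻¹ div h` of the vector field
`h`; at the origin the division gives `0`. -/
def potentialSymbol (h : PiLp 1 fun _ : Fin d => Rd d →₁[volume] ℂ) (ξ : Rd d) : ℂ :=
  (∑ i, derivSymbol (stdVec i) ξ * fourierAt ξ (h i)) / ∑ i, derivSymbol (stdVec i) ξ ^ 2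

variable {h : PiLp 1 fun _ : Fin d => Rd d →₁[volume] ℂ}

theorem aestronglyMeasurable_potentialSymbol :
    AEStronglyMeasurable (potentialSymbol h) volume := by
  have hnum : Continuous fun ξ => ∑ i, derivSymbol (stdVec i) ξ * fourierAt ξ (h i) :=
    continuous_finsetSum _ fun i _ =>
      (continuous_derivSymbol _).mul (continuous_fourier (L1.integrable_coeFn (h i)))
  have hden : Continuous fun ξ : Rd d => ∑ i, derivSymbol (stdVec i) ξ ^ 2 :=
    continuous_finsetSum _ fun i _ => (continuous_derivSymbol _).pow 2
  exact (hnum.measurable.div hden.measurable).aestronglyMeasurable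

theorem norm_sum_derivSymbol_mul_fourierAt_le (ξ : Rd d) :
    ‖∑ i, derivSymbol (stdVec i) ξ * fourierAt ξ (h i)‖ ≤ 2 * Real.pi * ‖ξ‖ * ‖h‖ := by
  rw [PiLp.norm_eq_of_L1, Finset.mul_sum]
  refine (norm_sum_le _ _).trans (Finset.sum_le_sum fun i _ => ?_)
  rw [norm_mul, norm_derivSymbol]
  gcongr
  · simpa using abs_real_inner_le_norm ξ (stdVec i)
  · exact norm_fourierAt_le ξ (h i)

theorem norm_potentialSymbol_le (ξ : Rd d) : ‖potentialSymbol h ξ‖ ≤ ‖h‖ / ‖ξ‖ := by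
  rcases eq_or_ne ξ 0 with rfl | hξ
  · simp [potentialSymbol, derivSymbol_zero]
  have hpos := norm_pos_iff.2 hξ
  have hπ : 1 ≤ 2 * Real.pi := by linarith [Real.pi_gt_three]
  rw [potentialSymbol, sum_derivSymbol_sq, norm_div, Complex.norm_real, neg_mul, norm_neg,
    Real.norm_of_nonneg (by positivity), div_le_div_iff₀ (by positivity) hpos]
  calc _ ≤ 2 * Real.pi * ‖ξ‖ * ‖h‖ * ‖ξ‖ := by
        gcongr
        exact norm_sum_derivSymbol_mul_fourierAt_le ξ
    _ = 2 * Real.pi * 1 * (‖h‖ * ‖ξ‖ ^ 2) := by ring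
    _ ≤ 2 * Real.pi * (2 * Real.pi) * (‖h‖ * ‖ξ‖ ^ 2) := by gcongr
    _ = ‖h‖ * ((2 * Real.pi) ^ 2 * ‖ξ‖ ^ 2) := by ring

theorem derivSymbol_mul_potentialSymbol (hh : h ∈ curlFree d) (j : Fin d) {ξ : Rd d}
    (hξ : ξ ≠ 0) : derivSymbol (stdVec j) ξ * potentialSymbol h ξ = fourierAt ξ (h j) := by
  rw [potentialSymbol, mul_div_assoc', div_eq_iff (sum_derivSymbol_sq_ne_zero hξ), Finset.mul_sum,
    Finset.mul_sum]
  refine Finset.sum_congr rfl fun i _ => ?_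
  linear_combination (-derivSymbol (stdVec i) ξ) * mem_curlFree.1 hh i j ξ

theorem ae_ne_zero (j : Fin d) : ∀ᵐ ξ : Rd d, ξ ≠ 0 := by
  have : NeZero d := ⟨j.pos.ne'⟩
  exact compl_mem_ae_iff.2 (measure_singleton 0)

theorem integral_fourierInv_lineDerivOp_mul_potentialSymbol (hh : h ∈ curlFree d) (j : Fin d)
    (φ : 𝓢(Rd d, ℂ)) :
    ∫ ξ, 𝓕⁻ (∂_{stdVec j} φ : 𝓢(Rd d, ℂ)) ξ * potentialSymbol h ξ = -∫ x, φ x * h j x := by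
  calc ∫ ξ, 𝓕⁻ (∂_{stdVec j} φ : 𝓢(Rd d, ℂ)) ξ * potentialSymbol h ξ
      = ∫ ξ, -(𝓕⁻ φ ξ * 𝓕 (h j : Rd d → ℂ) ξ) := integral_congr_ae <| by
        filter_upwards [ae_ne_zero j] with ξ hξ
        rw [fourierInv_lineDerivOp_apply, ← fourierAt_apply,
          ← derivSymbol_mul_potentialSymbol hh j hξ]
        ring
    _ = -∫ x, φ x * h j x := by
        rw [integral_neg, ← integral_fourier_mul (𝓕⁻ φ).integrable (L1.integrable_coeFn (h j)),
          ← SchwartzMap.fourier_coe, FourierTransform.fourier_fourierInv_eq]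

theorem exists_gradient_eq (hh : h ∈ curlFree d) : ∃ q : W11 d, gradient d q = h := by
  obtain ⟨v, hv⟩ := exists_temperedDistribution_eq_integral_of_norm_le_div (norm_nonneg h)
    norm_potentialSymbol_le aestronglyMeasurable_potentialSymbol
  obtain ⟨u, hu⟩ := exists_isRestriction (𝓕⁻ v)
  have hpderiv (j : Fin d) : pderiv j u = ofL1 d (h j) := by
    ext φ
    rw [pderiv_apply, hu, testToSchwartz_lineDerivOp, TemperedDistribution.fourierInv_apply, hv,
      integral_fourierInv_lineDerivOp_mul_potentialSymbol hh, neg_neg]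
    · exact (ofFun_apply_eq_integral_mul (L1_locallyIntegrable (h j)) φ).symm
    · rw [fourierInv_lineDerivOp_apply, derivSymbol_zero, zero_mul, neg_zero]
  have hu_mem : u ∈ w11 d := (Submodule.mem_iInf _).2 fun j => ⟨h j, (hpderiv j).symm⟩
  let w : PreW11 d := ⟨u, hu_mem⟩
  exact ⟨Submodule.Quotient.mk w, PiLp.ext fun j =>
    ofL1_injective d ((PreW11.ofL1_grad j w).trans (hpderiv j))⟩

end Potential

section Extension

theorem exists_rightInverse_apply_apply_eq {K W X : Type*} [DivisionRing K] [AddCommGroup W]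
    [Module K W] [AddCommGroup X] [Module K X] {π : W →ₗ[K] X} (hπ : Function.Surjective π)
    {R : Submodule K W} (hR : Disjoint R (LinearMap.ker π)) :
    ∃ σ : X →ₗ[K] W, (∀ x, π (σ x) = x) ∧ ∀ w ∈ R, σ (π w) = w := by
  obtain ⟨σ₀, hσ₀⟩ := π.exists_rightInverse_of_surjective (LinearMap.range_eq_top.2 hπ)
  have hinj : LinearMap.ker (π ∘ₗ R.subtype) = ⊥ := LinearMap.ker_eq_bot'.2 fun w hw =>
    Subtype.ext (Submodule.disjoint_def.1 hR w w.2 hw)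
  obtain ⟨g, hg⟩ := (π ∘ₗ R.subtype).exists_leftInverse_of_injective hinj
  refine ⟨σ₀ ∘ₗ (LinearMap.id - π ∘ₗ R.subtype ∘ₗ g) + R.subtype ∘ₗ g, fun x => ?_, fun w hw => ?_⟩
  · have hσ₀x (y : X) : π (σ₀ y) = y := LinearMap.congr_fun hσ₀ y
    simp [hσ₀x]
  · have hgw : g (π w) = ⟨w, hw⟩ := LinearMap.congr_fun hg ⟨w, hw⟩
    simp [hgw]

theorem exists_continuousLinearMap_extension {𝕜 E X F M : Type*} [RCLike 𝕜] [AddCommGroup E]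
    [Module 𝕜 E] [NormedAddCommGroup X] [NormedSpace 𝕜 X] [NormedAddCommGroup F] [NormedSpace 𝕜 F]
    [CompleteSpace F] [NormedAddCommGroup M] [NormedSpace 𝕜 M] [FiniteDimensional 𝕜 M]
    (L : X →L[𝕜] M) (e : E →ₗ[𝕜] X) (B : E →ₗ[𝕜] F) (hL : ∀ v, L (e v) = 0)
    (he : ∀ x, L x = 0 → x ∈ closure (Set.range e)) {C : ℝ} (hB : ∀ v, ‖B v‖ ≤ C * ‖e v‖) :
    ∃ S : X →L[𝕜] F, ∀ v, S (e v) = B v := by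
  let e₀ : E →ₗ[𝕜] L.toLinearMap.ker := e.codRestrict _ hL
  have hdense : DenseRange e₀ := by
    refine Metric.denseRange_iff.2 fun x r hr => ?_
    obtain ⟨_, ⟨v, rfl⟩, hv⟩ := Metric.mem_closure_iff.1 (he x x.2) r hr
    exact ⟨v, hv⟩
  obtain ⟨P, hP⟩ := L.ker_closedComplemented_of_finiteDimensional_range
  refine ⟨(B.extendOfNorm e₀).comp P, fun v => ?_⟩
  rw [ContinuousLinearMap.comp_apply, show e v = (e₀ v : X) from rfl, hP]
  exact LinearMap.extendOfNorm_eq hdense ⟨C, hB⟩ v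

variable {d : ℕ}

/-- The gradient as an isometry into the curl-free fields. -/
def gradientCurlFree (d : ℕ) : W11 d →ₗᵢ[ℂ] curlFree d where
  toLinearMap := (gradient d).toLinearMap.codRestrict (curlFree d) gradient_mem_curlFree
  norm_map' q := (gradient d).norm_map q

theorem surjective_gradientCurlFree (d : ℕ) : Function.Surjective (gradientCurlFree d) := by
  rintro ⟨h, hh⟩
  obtain ⟨q, hq⟩ := exists_gradient_eq hh
  exact ⟨q, Subtype.ext hq⟩

/-- The integrals of the components of a curl-free field, which are its only obstructions to being
approximated by gradients of Schwartz functions. -/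
def curlFreeIntegral (d : ℕ) : curlFree d →L[ℂ] (Fin d → ℂ) :=
  ContinuousLinearMap.pi fun j => (componentFourierAt 0 j).comp (curlFree d).subtypeL

theorem curlFreeIntegral_gradientCurlFree_ofSchwartz (f : 𝓢(Rd d, ℂ)) :
    curlFreeIntegral d (gradientCurlFree d (ofSchwartz f)) = 0 := by
  funext j
  change fourierAt 0 (gradient d (ofSchwartz f) j) = 0
  rw [gradient_ofSchwartz, fourierAt_toLp, fourier_lineDerivOp_apply, derivSymbol_zero, zero_mul]

theorem mem_closure_range_gradientCurlFree_ofSchwartz {h : curlFree d}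
    (hh : curlFreeIntegral d h = 0) :
    h ∈ closure (Set.range fun f => gradientCurlFree d (ofSchwartz f)) := by
  rw [closure_subtype, ← Set.range_comp]
  exact mem_closure_range_gradient_ofSchwartz h.2 (congrFun hh)

/-- The linear map sending a Schwartz function `f` to the class of `𝓕⁻ (m * 𝓕 f)`. -/
def multiplierOp {m : Rd d → ℂ} (hm : MemLp m ∞ volume) (h : ∀ f, multiplierDistr hm f ∈ w11 d) :
    𝓢(Rd d, ℂ) →ₗ[ℂ] W11 d :=
  (constants d).mkQ ∘ₗ
    ((multiplierDistr hm).codRestrict (w11 d) h : 𝓢(Rd d, ℂ) →ₗ[ℂ] PreW11 d)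

theorem exists_linearMap_eq_ofSchwartz (d : ℕ) :
    ∃ e : 𝓢(Rd d, ℂ) →ₗ[ℂ] W11 d, ∀ f, e f = ofSchwartz f := by
  have hmem (f : 𝓢(Rd d, ℂ)) : multiplierDistr (memLp_top_const (1 : ℂ)) f ∈ w11 d :=
    ofFun_eq_multiplierDistr_one f ▸ schwartz_mem f
  exact ⟨multiplierOp _ hmem, fun f => congrArg Submodule.Quotient.mk
    (Subtype.ext (ofFun_eq_multiplierDistr_one f).symm)⟩

/- The extension takes place in the complete space `curlFree d` and is lifted back to the seminormed
space `W11 d` by a right inverse `σ` of the gradient. Choosing `σ` so that it fixes the range of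
`T₀` makes it unnecessary to know that distributions with zero gradient are constant. -/
theorem exists_continuousLinearMap_ofSchwartz {T₀ : 𝓢(Rd d, ℂ) →ₗ[ℂ] W11 d} {C : ℝ}
    (hbound : ∀ f, ‖T₀ f‖ ≤ C * ‖ofSchwartz f‖) (hker : ∀ f, ‖T₀ f‖ = 0 → T₀ f = 0) :
    ∃ T : W11 d →L[ℂ] W11 d, ∀ f, T (ofSchwartz f) = T₀ f := by
  let G := gradientCurlFree d
  obtain ⟨e, he⟩ := exists_linearMap_eq_ofSchwartz d
  have hclosure (h : curlFree d) (hh : curlFreeIntegral d h = 0) :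
      h ∈ closure (Set.range (G.toLinearMap ∘ₗ e)) := by
    rw [show ⇑(G.toLinearMap ∘ₗ e) = fun f => G (ofSchwartz f) from
      funext fun f => congrArg G (he f)]
    exact mem_closure_range_gradientCurlFree_ofSchwartz hh
  obtain ⟨S, hS⟩ := exists_continuousLinearMap_extension (curlFreeIntegral d)
    (G.toLinearMap ∘ₗ e) (G.toLinearMap ∘ₗ T₀)
    (fun f => by simpa [he] using curlFreeIntegral_gradientCurlFree_ofSchwartz f)
    hclosure (C := C) fun f => by simpa [G, he, (gradientCurlFree d).norm_map] using hbound f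
  have hdisjoint : Disjoint (LinearMap.range T₀) (LinearMap.ker G.toLinearMap) := by
    refine Submodule.disjoint_def.2 ?_
    rintro _ ⟨f, rfl⟩ hf
    exact hker f (by rw [← G.norm_map, show G (T₀ f) = 0 from hf, norm_zero])
  obtain ⟨σ, hGσ, hσ⟩ :=
    exists_rightInverse_apply_apply_eq (surjective_gradientCurlFree d) hdisjoint
  have hσ_norm (h : curlFree d) : ‖σ h‖ = ‖h‖ := by
    rw [← G.norm_map]
    exact congrArg norm (hGσ h)
  refine ⟨(LinearIsometry.mk σ hσ_norm).toContinuousLinearMap.comp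
    (S.comp G.toContinuousLinearMap), fun f => ?_⟩
  calc σ (S (G (ofSchwartz f))) = σ (G (T₀ f)) := congrArg σ (by simpa [he] using hS f)
    _ = T₀ f := hσ _ ⟨f, rfl⟩

end Extension

section Limit

theorem fourierInv_eq_integral_of_ae_eq_zero {V : Type*} [NormedAddCommGroup V]
    [InnerProductSpace ℝ V] [FiniteDimensional ℝ V] [MeasurableSpace V] [BorelSpace V] {g : V → ℂ}
    (hg : ∀ᵐ ξ, ξ ≠ 0 → g ξ = 0) (x : V) : 𝓕⁻ g x = ∫ ξ, g ξ := by
  rw [Real.fourierInv_eq]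
  refine integral_congr_ae ?_
  filter_upwards [hg] with ξ hξ
  obtain rfl | hne := eq_or_ne ξ 0
  · simp
  · rw [hξ hne, smul_zero]

variable {d : ℕ} {m : Rd d → ℂ}

theorem ofFun_const (c : ℂ) : ofFun (fun _ : Rd d => c) = c • ofFun fun _ => (1 : ℂ) := by
  ext φ
  change ofFun _ φ = c • ofFun _ φ
  simp only [ofFun_apply_eq_integral_mul continuous_const.locallyIntegrable, mul_one,
    integral_mul_const, smul_eq_mul, mul_comm c]

theorem mem_constants_of_grad_eq_zero {hm : MemLp m ∞ volume} {f : 𝓢(Rd d, ℂ)} {u : PreW11 d}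
    (hu : PreW11.toDistr d u = multiplierDistr hm f) (hgrad : ∀ j, PreW11.grad j u = 0) :
    u ∈ constants d := by
  have hzero : ∀ᵐ ξ, ξ ≠ 0 → m ξ * 𝓕 f ξ = 0 := by
    filter_upwards [ae_all_iff.2 (fourierAt_grad_ae_eq hu)] with ξ hξ hne
    by_contra hmf
    have hsymbol (j : Fin d) : derivSymbol (stdVec j) ξ = 0 := by
      simpa [hgrad, hmf, eq_comm] using hξ j
    exact hne (norm_le_zero_iff.1 (by simpa [hsymbol] using norm_le_sum_norm_derivSymbol ξ))
  refine Submodule.mem_comap.2 (Submodule.mem_span_singleton.2 ⟨∫ ξ, m ξ * 𝓕 f ξ, ?_⟩)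
  rw [hu, multiplierDistr_apply, ← ofFun_const]
  exact congrArg ofFun (funext fun x => (fourierInv_eq_integral_of_ae_eq_zero hzero x).symm)

theorem multiplierOp_eq_zero_of_norm_eq_zero {hm : MemLp m ∞ volume}
    {hmem : ∀ f, multiplierDistr hm f ∈ w11 d} {f : 𝓢(Rd d, ℂ)}
    (hf : ‖multiplierOp hm hmem f‖ = 0) : multiplierOp hm hmem f = 0 := by
  let u : PreW11 d := ⟨multiplierDistr hm f, hmem f⟩
  have hnorm : ‖(Submodule.Quotient.mk u : W11 d)‖ = 0 := hf
  rw [norm_mk_eq, PreW11.norm_def, Finset.sum_eq_zero_iff_of_nonneg fun j _ => norm_nonneg _]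
    at hnorm
  exact (Submodule.Quotient.mk_eq_zero _).2 (mem_constants_of_grad_eq_zero (hm := hm) (u := u) rfl
    fun j => norm_eq_zero.1 (hnorm j (Finset.mem_univ j)))

theorem IsMultiplierWith.eLpNorm_fourierInv_le {T : W11 d →L[ℂ] W11 d} (hT : IsMultiplierWith m T)
    (f : 𝓢(Rd d, ℂ)) (j : Fin d) :
    eLpNorm (𝓕⁻ fun ξ => m ξ * 𝓕 (∂_{stdVec j} f : 𝓢(Rd d, ℂ)) ξ) 1 volume ≤
      ENNReal.ofReal (‖T‖ * ‖ofSchwartz f‖) := by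
  obtain ⟨hm, h⟩ := isMultiplierWith_iff.1 hT
  obtain ⟨u, hu, hTu⟩ := h f
  rw [← eLpNorm_congr_ae (grad_ae_eq_of_toDistr_eq hu j), ← Lp.enorm_def, ← ofReal_norm]
  gcongr
  calc ‖PreW11.grad j u‖ ≤ ∑ i, ‖PreW11.grad i u‖ :=
        Finset.single_le_sum (f := fun i => ‖PreW11.grad i u‖) (fun i _ => norm_nonneg _)
          (Finset.mem_univ j)
    _ = ‖T (ofSchwartz f)‖ := by rw [hTu, norm_mk_eq, PreW11.norm_def]
    _ ≤ ‖T‖ * ‖ofSchwartz f‖ := T.le_opNorm _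

variable {ms : ℕ → Rd d → ℂ} {Ts : ℕ → (W11 d →L[ℂ] W11 d)} {C : ℝ}

theorem eLpNorm_fourierInv_limit_le (hT : ∀ k, IsMultiplierWith (ms k) (Ts k))
    (hC : ∀ k, ‖Ts k‖ ≤ C) (hlim : ∀ᵐ ξ, Tendsto (ms · ξ) atTop (𝓝 (m ξ))) (f : 𝓢(Rd d, ℂ))
    (j : Fin d) :
    eLpNorm (𝓕⁻ fun ξ => m ξ * 𝓕 (∂_{stdVec j} f : 𝓢(Rd d, ℂ)) ξ) 1 volume ≤
      ENNReal.ofReal (C * ‖ofSchwartz f‖) := by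
  set F : 𝓢(Rd d, ℂ) := 𝓕 (∂_{stdVec j} f)
  refine HomSobolev.eLpNorm_fourierInv_le (g := fun k ξ => ms k ξ * F ξ)
    (bound := fun ξ => C * ‖ofSchwartz (lowPass (Rd d))‖ * ‖F ξ‖)
    (fun k => (integrable_mul_schwartz (hT k).1 F).aestronglyMeasurable)
    (F.integrable.norm.const_mul _) (fun k => ?_) ?_ fun k => ?_
  · filter_upwards [(hT k).ae_norm_le, ae_ne_zero j] with ξ hξ hne
    rw [norm_mul]
    gcongr
    exact (hξ hne).trans (mul_le_mul_of_nonneg_right (hC k) (norm_nonneg _))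
  · filter_upwards [hlim] with ξ hξ
    exact hξ.mul_const _
  · exact ((hT k).eLpNorm_fourierInv_le f j).trans (ENNReal.ofReal_le_ofReal
      (mul_le_mul_of_nonneg_right (hC k) (norm_nonneg _)))

theorem multiplierDistr_limit_mem_w11 (hm : MemLp m ∞ volume)
    (hT : ∀ k, IsMultiplierWith (ms k) (Ts k)) (hC : ∀ k, ‖Ts k‖ ≤ C)
    (hlim : ∀ᵐ ξ, Tendsto (ms · ξ) atTop (𝓝 (m ξ))) (f : 𝓢(Rd d, ℂ)) :
    multiplierDistr hm f ∈ w11 d :=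
  multiplierDistr_mem_w11 hm f fun j => memLp_one_iff_integrable.1
    ⟨(continuous_fourierInv (integrable_mul_schwartz hm _)).aestronglyMeasurable,
      (eLpNorm_fourierInv_limit_le hT hC hlim f j).trans_lt ENNReal.ofReal_lt_top⟩

theorem norm_multiplierOp_limit_le {hm : MemLp m ∞ volume}
    {hmem : ∀ f, multiplierDistr hm f ∈ w11 d} (hT : ∀ k, IsMultiplierWith (ms k) (Ts k))
    (hC : ∀ k, ‖Ts k‖ ≤ C) (hlim : ∀ᵐ ξ, Tendsto (ms · ξ) atTop (𝓝 (m ξ))) (f : 𝓢(Rd d, ℂ)) :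
    ‖multiplierOp hm hmem f‖ ≤ d * C * ‖ofSchwartz f‖ := by
  let u : PreW11 d := ⟨multiplierDistr hm f, hmem f⟩
  have hC₀ : 0 ≤ C := (norm_nonneg (Ts 0)).trans (hC 0)
  have hgrad (j : Fin d) : ‖PreW11.grad j u‖ ≤ C * ‖ofSchwartz f‖ := by
    rw [← ENNReal.ofReal_le_ofReal_iff (by positivity), ofReal_norm, Lp.enorm_def,
      eLpNorm_congr_ae (grad_ae_eq_of_toDistr_eq (hm := hm) (u := u) rfl j)]
    exact eLpNorm_fourierInv_limit_le hT hC hlim f j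
  calc ‖multiplierOp hm hmem f‖ = ∑ j, ‖PreW11.grad j u‖ :=
        (norm_mk_eq u).trans (PreW11.norm_def u)
    _ ≤ ∑ _j : Fin d, C * ‖ofSchwartz f‖ := Finset.sum_le_sum fun j _ => hgrad j
    _ = d * C * ‖ofSchwartz f‖ := by simp [mul_assoc]

end Limit

end HomSobolev

end

theorem mainTheorem2_general {d : ℕ}
    (m : ℕ → HomSobolev.Rd d → ℂ) (m₀ : HomSobolev.Rd d → ℂ)
    (T : ℕ → (HomSobolev.W11 d →L[ℂ] HomSobolev.W11 d))
    (hT : ∀ k, HomSobolev.IsMultiplierWith (m k) (T k))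
    (hbdd : ∃ C : ℝ, ∀ k, ‖T k‖ ≤ C)
    (hlim : ∀ᵐ ξ, Filter.Tendsto (fun k => m k ξ) Filter.atTop (nhds (m₀ ξ))) :
    HomSobolev.IsMultiplier m₀ := by
  obtain ⟨C, hC⟩ := hbdd
  have hm₀ := HomSobolev.memLp_top_of_tendsto hT hC hlim
  have hmem := HomSobolev.multiplierDistr_limit_mem_w11 hm₀ hT hC hlim
  obtain ⟨T₀, hT₀⟩ := HomSobolev.exists_continuousLinearMap_ofSchwartz
    (HomSobolev.norm_multiplierOp_limit_le (hmem := hmem) hT hC hlim)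
    fun _ => HomSobolev.multiplierOp_eq_zero_of_norm_eq_zero
  exact ⟨T₀, HomSobolev.isMultiplierWith_iff.2 ⟨hm₀, fun f => ⟨⟨_, hmem f⟩, rfl, hT₀ f⟩⟩⟩

theorem mainTheorem2 {d : ℕ}
    (m : ℕ → HomSobolev.Rd d → ℂ) (m₀ : HomSobolev.Rd d → ℂ)
    (T : ℕ → (HomSobolev.W11 d →L[ℂ] HomSobolev.W11 d))
    (hT : ∀ k, HomSobolev.IsMultiplierWith (m k) (T k))
    (hbdd : ∃ C : ℝ, ∀ k, ‖T k‖ ≤ C)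
    (hlim : ∀ ξ, Filter.Tendsto (fun k => m k ξ) Filter.atTop (nhds (m₀ ξ)))
    (hcont : ∀ j : Fin d, Continuous (fun ξ : HomSobolev.Rd d => m₀ ξ * ((ξ j : ℝ) : ℂ))) :
    HomSobolev.IsMultiplier m₀ :=
  mainTheorem2_general m m₀ T hT hbdd (MeasureTheory.ae_of_all _ hlim)
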